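/- **Setting.** Let $\mathcal N=\{1,\dots,N\}$, $\mathcal J=\{1,\dots,J\}$, and for $i\in\mathcal N$ let $A(i)\in\mathbb R^{n\times n}$, $B(i)\in\mathbb R^{n\times m}$, $C(i)\in\mathbb R^{q\times n}$, $D(i)\in\mathbb R^{q\times m}$. Let $\Pi(s)=(\pi_{ij}(s))$, $s\in\mathcal J$, be $N\times N$ row-stochastic matrices, let $\Psi$ be a set of sequences $\psi:\{1,2,\dots\}\to\mathcal J$, and let $p(0)$ be a probability distribution on $\mathcal N$. On a probability space $(\Omega,\mathfrak F,\mathbf P)$, for each $\psi\in\Psi$, let $\theta=\theta_\psi$ be a Markov chain in $\mathcal N$ with initial distribution $p(0)$ and $\mathbf P\{\theta(k)=j\mid\theta(k-1)=i\}=\pi_{ij}(\psi(k))$, $k\ge1$. The switched Markov jump linear system is the family, indexed by $\psi\in\Psi$, of the systems $$x(k+1)=A(\theta(k))x(k)+B(\theta(k))w(k),\qquad z(k)=C(\theta(k))x(k)+D(\theta(k))w(k),\qquad k\ge 0 .$$ Matrix inequalities are in the Loewner order on symmetric matrices. Put $\Phi(k,j)=A(\theta(k-1))\cdots A(\theta(j))$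 for $k>j$ and $\Phi(j,j)=I$. Put $\|w\|_{2,e}^2=\sum_{k\ge0}\mathbf E\|w(k)\|^2$ (Euclidean norm inside), and let $\ell^2_e$ be the set of all $\mathbb R^m$-valued stochastic processes $w$ on $\Omega$ with $\|w\|_{2,e}<\infty$. * The system is *uniformly exponentially mean square stable* if there are $c\ge1$ and $0\le\lambda<1$ with $\mathbf E[\Phi(k,j)^{T}\Phi(k,j)\mid\theta(j)=i]\le c\lambda^{k-j}I$ for all $i\in\mathcal N$, $k\ge j\ge0$, $\psi\in\Psi$. * The system is *uniformly mean square strictly contractive* if there is $\gamma\in(0,1)$ such that, with $x(0)=0$, $\|z\|_{2,e}\le\gamma\|w\|_{2,e}$ for all $w\in\ell^2_e$ and $\psi\in\Psi$. Define $$\mathcal B(i,X,Y)=\begin{bmatrix}A(i)&B(i)\\C(i)&D(i)\end{bmatrix}^{T}\begin{bmatrix}X&0\\0&I\end{bmatrix}\begin{bmatrix}A(i)&B(i)\\C(i)&D(i)\end{bmatrix}-\begin{bmatrix}Y&0\\0&I\end{bmatrix},$$ $\mathcal L(i,X)=A(i)^TXA(i)+C(i)^TC(i)$, $\mathcal R(i,X)=B(i)^TXA(i)+D(i)^TC(i)$,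 $\mathcal W(i,X)=I-B(i)^TXB(i)-D(i)^TD(i)$ and, when $X$ is symmetric and $\mathcal W(i,X)$ is invertible, $\mathcal S(i,X)=\mathcal L(i,X)+\mathcal R(i,X)^T\mathcal W(i,X)^{-1}\mathcal R(i,X)$. For $\epsilon>0$, $T\in\mathbb N_0$ and $\psi\in\Psi$ let $X_\psi(i,T+1,T,\epsilon)=0$ and $$X_\psi(i,k,T,\epsilon)=\mathcal S\big(i,\tilde X_\psi(i,k+1,T,\epsilon)\big)+\epsilon I\quad(0\le k\le T),\qquad \tilde X_\psi(i,k+1,T,\epsilon)=\sum_{j=1}^N\pi_{ij}(\psi(k+1))X_\psi(j,k+1,T,\epsilon).$$ For $M\in\mathbb N_0$ put $\psi_M(k)=(\psi(k+1),\dots,\psi(k+M))$. **Statement.** Assume $\mathbf P\{\theta_\psi(k)=i\}>0$ for all $\psi\in\Psi$, $i\in\mathcal N$, $k\in\mathbb N_0$, and that the switched system is uniformly exponentially mean square stable and uniformly mean square strictly contractive. Then: 1. There exist $\eta,\rho,\nu>0$ and $M\in\mathbb N_0$ and, for each $\psi\in\Psi$, a function $Y_\psi$ from $\mathcal N\times\mathbb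 N_0$ to the symmetric positive definite $n\times n$ matrices such that $Y_\psi(i,k)$ depends only on $i$ and $\psi_M(k)$ (that is, $\psi_M(k)=\varphi_M(t)$ implies $Y_\psi(i,k)=Y_\varphi(i,t)$, for all $\psi,\varphi\in\Psi$, $i\in\mathcal N$ and $k,t\in\mathbb N_0$) and, for all $\psi\in\Psi$, $i\in\mathcal N$, $k\in\mathbb N_0$, $$\eta I\le Y_\psi(i,k)\le\rho I,\qquad \mathcal B\big(i,\tilde Y_\psi(i,k+1),Y_\psi(i,k)\big)\le-\nu I,$$ where $\tilde Y_\psi(i,k+1)=\sum_{j=1}^N\pi_{ij}(\psi(k+1))Y_\psi(j,k+1)$. 2. More explicitly, there exist $\eta,\rho>0$ such that for every $\epsilon\in(0,\eta)$ the matrices $X_\psi(i,k,T,\epsilon)$ are well defined (each $\tilde X_\psi(i,k+1,T,\epsilon)$, $0\le k\le T$, is symmetric and $\mathcal W(i,\tilde X_\psi(i,k+1,T,\epsilon))$ is invertible), and there exist $M\in\mathbb N_0$ and $\nu>0$ such that $Y_\psi(i,k):=X_\psi(i,k,k+M,\epsilon)$ has all the properties in part 1, with the constants $\epsilon,\rho,\nu$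 in place of $\eta,\rho,\nu$ and with this $M$. -/

import Mathlib

open MeasureTheory
open scoped ENNReal MatrixOrder

noncomputable section

namespace SwitchedMJLS

/-! The order `≤` on real square matrices is the Loewner order: `X ≤ Y` means that `Y - X` is
symmetric positive semidefinite (opened by `MatrixOrder`). -/

/-- The family `𝒢 = {(A(i), B(i), C(i), D(i)) : i ∈ 𝒩}`, where `𝒩` is a set with `N` elements,
the state has dimension `n`, the disturbance dimension `m` and the error dimension `q`. -/
structure SystemMatrices (N n m q : ℕ) where
  A : Fin N → Matrix (Fin n) (Fin n) ℝ
  B : Fin N → Matrix (Fin n) (Fin m) ℝ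
  C : Fin N → Matrix (Fin q) (Fin n) ℝ
  D : Fin N → Matrix (Fin q) (Fin m) ℝ

/-- `θ` is a (time-inhomogeneous) Markov chain on `(Ω, P)` with values in `Fin N`, with initial
distribution `p₀` and with `T (k + 1)` as matrix of the transition probabilities
`P(θ(k+1) = j | θ(k) = i)`.
The Markov property is written in product form
`P(θ(0) = i₀, …, θ(k+1) = iₖ₊₁) = P(θ(0) = i₀, …, θ(k) = iₖ) · T (k+1) iₖ iₖ₊₁`,
so that nothing is conditioned on a null event. -/
def IsMarkovChain {Ω : Type*} [MeasurableSpace Ω] {N : ℕ} (P : Measure Ω)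
    (θ : ℕ → Ω → Fin N) (p₀ : Fin N → ℝ) (T : ℕ+ → Matrix (Fin N) (Fin N) ℝ) : Prop :=
  (∀ k, Measurable (θ k)) ∧
  (∀ i, P.real {ω | θ 0 ω = i} = p₀ i) ∧
  ∀ (k : ℕ) (path : ℕ → Fin N),
    P.real {ω | ∀ l ≤ k + 1, θ l ω = path l} =
      P.real {ω | ∀ l ≤ k, θ l ω = path l} * T k.succPNat (path k) (path (k + 1))

/-- A switching sequence `ψ : {1, 2, …} → {1, …, J}`. -/
abbrev SwitchingSequence (J : ℕ) := ℕ+ → Fin J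

/-- `ψ_M(k) = (ψ(k+1), …, ψ(k+M))`. -/
def window {J : ℕ} (ψ : SwitchingSequence J) (M k : ℕ) : Fin M → Fin J :=
  fun l => ψ (k + (l : ℕ)).succPNat

section System

variable {N n m q : ℕ} (G : SystemMatrices N n m q)

/-- The state transition matrix `Φ(k, j) = A(path (k-1)) ⋯ A(path j)` for `k > j`, and
`Φ(j, j) = I`, along a realization `path` of the chain. It is only used for `j ≤ k`. -/
def transition (path : ℕ → Fin N) : ℕ → ℕ → Matrix (Fin n) (Fin n) ℝ
  | 0, _ => 1
  | k + 1, j => if j ≤ k then G.A (path k) * transition path k j else 1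

/-- The state `x(k)` along a realization `path` of the chain, with initial state `x₀` and
disturbance `w`: `x(0) = x₀` and `x(k+1) = A(path k) x(k) + B(path k) w(k)`. -/
def state (path : ℕ → Fin N) (x₀ : EuclideanSpace ℝ (Fin n))
    (w : ℕ → EuclideanSpace ℝ (Fin m)) : ℕ → EuclideanSpace ℝ (Fin n)
  | 0 => x₀
  | k + 1 => Matrix.toEuclideanLin (G.A (path k)) (state path x₀ w k)
      + Matrix.toEuclideanLin (G.B (path k)) (w k)

/-- The error `z(k) = C(path k) x(k) + D(path k) w(k)`. -/
def output (path : ℕ → Fin N) (x₀ : EuclideanSpace ℝ (Fin n))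
    (w : ℕ → EuclideanSpace ℝ (Fin m)) (k : ℕ) : EuclideanSpace ℝ (Fin q) :=
  Matrix.toEuclideanLin (G.C (path k)) (state G path x₀ w k)
    + Matrix.toEuclideanLin (G.D (path k)) (w k)

end System

section Probability

variable {Ω : Type*} [MeasurableSpace Ω]

/-- The expectation `E[F | θ = i]` of a random matrix, taken entrywise, conditioned on the
elementary event `{θ = i}`. -/
def condExpect {N n : ℕ} (P : Measure Ω) (θ : Ω → Fin N) (i : Fin N)
    (F : Ω → Matrix (Fin n) (Fin n) ℝ) : Matrix (Fin n) (Fin n) ℝ :=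
  Matrix.of fun a b => ∫ ω, F ω a b ∂(ProbabilityTheory.cond P {ω | θ ω = i})

/-- `‖w‖_{2,e} = (∑ₖ E ‖w(k)‖²)^{1/2}`, with values in `[0, ∞]`. -/
def l2eNorm {d : ℕ} (P : Measure Ω) (w : ℕ → Ω → EuclideanSpace ℝ (Fin d)) : ℝ≥0∞ :=
  (∑' k, ∫⁻ ω, ‖w k ω‖ₑ ^ 2 ∂P) ^ (1 / 2 : ℝ)

/-- `w ∈ ℓ²_e`: a mean square summable stochastic process. -/
def MemL2e {d : ℕ} (P : Measure Ω) (w : ℕ → Ω → EuclideanSpace ℝ (Fin d)) : Prop :=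
  (∀ k, Measurable (w k)) ∧ l2eNorm P w < ∞

variable {N n m q J : ℕ}

/-- The switched system given by `G`, by the set `Ψ` of switching sequences and by the chains
`θ ψ`, `ψ ∈ Ψ`, is uniformly exponentially mean square stable: there are `c ≥ 1` and
`0 ≤ lam < 1` with `E[Φ(k,j)ᵀ Φ(k,j) | θ(j) = i] ≤ c lam^(k-j) I` for all `i`, all `k ≥ j ≥ 0`
and all `ψ ∈ Ψ`. -/
def UniformlyExpMeanSquareStable (G : SystemMatrices N n m q) (P : Measure Ω)
    (Ψ : Set (SwitchingSequence J)) (θ : SwitchingSequence J → ℕ → Ω → Fin N) : Prop :=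
  ∃ c lam : ℝ, 1 ≤ c ∧ 0 ≤ lam ∧ lam < 1 ∧
    ∀ ψ ∈ Ψ, ∀ (i : Fin N) (k j : ℕ), j ≤ k →
      condExpect P (θ ψ j) i (fun ω =>
          (transition G (fun l => θ ψ l ω) k j).transpose * transition G (fun l => θ ψ l ω) k j)
        ≤ (c * lam ^ (k - j)) • (1 : Matrix (Fin n) (Fin n) ℝ)

/-- The switched system is uniformly mean square strictly contractive: there is `γ ∈ (0, 1)`
such that, with `x(0) = 0`, `‖z‖_{2,e} ≤ γ ‖w‖_{2,e}` for all `w ∈ ℓ²_e` and all `ψ ∈ Ψ`. -/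
def UniformlyMeanSquareStrictlyContractive (G : SystemMatrices N n m q) (P : Measure Ω)
    (Ψ : Set (SwitchingSequence J)) (θ : SwitchingSequence J → ℕ → Ω → Fin N) : Prop :=
  ∃ γ : ℝ, 0 < γ ∧ γ < 1 ∧
    ∀ ψ ∈ Ψ, ∀ w : ℕ → Ω → EuclideanSpace ℝ (Fin m), MemL2e P w →
      l2eNorm P (fun k ω => output G (fun l => θ ψ l ω) 0 (fun l => w l ω) k)
        ≤ ENNReal.ofReal γ * l2eNorm P w

end Probability

section Operators

variable {N n m q : ℕ} (G : SystemMatrices N n m q)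

/-- `ℬ(i, X, Y) = [A B; C D]ᵀ [X 0; 0 I] [A B; C D] - [Y 0; 0 I]`. -/
def kyp (i : Fin N) (X Y : Matrix (Fin n) (Fin n) ℝ) :
    Matrix (Fin n ⊕ Fin m) (Fin n ⊕ Fin m) ℝ :=
  (Matrix.fromBlocks (G.A i) (G.B i) (G.C i) (G.D i)).transpose
      * Matrix.fromBlocks X 0 0 (1 : Matrix (Fin q) (Fin q) ℝ)
      * Matrix.fromBlocks (G.A i) (G.B i) (G.C i) (G.D i)
    - Matrix.fromBlocks Y 0 0 (1 : Matrix (Fin m) (Fin m) ℝ)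

/-- `ℒ(i, X) = Aᵀ X A + Cᵀ C`. -/
def opL (i : Fin N) (X : Matrix (Fin n) (Fin n) ℝ) : Matrix (Fin n) (Fin n) ℝ :=
  (G.A i).transpose * X * G.A i + (G.C i).transpose * G.C i

/-- `ℛ(i, X) = Bᵀ X A + Dᵀ C`. -/
def opR (i : Fin N) (X : Matrix (Fin n) (Fin n) ℝ) : Matrix (Fin m) (Fin n) ℝ :=
  (G.B i).transpose * X * G.A i + (G.D i).transpose * G.C i

/-- `𝒲(i, X) = I - Bᵀ X B - Dᵀ D`. -/
def opW (i : Fin N) (X : Matrix (Fin n) (Fin n) ℝ) : Matrix (Fin m) (Fin m) ℝ :=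
  1 - (G.B i).transpose * X * G.B i - (G.D i).transpose * G.D i

/-- `𝕏ᵢ`: the symmetric matrices `X` with `𝒲(i, X)` invertible. -/
def domainS (i : Fin N) : Set (Matrix (Fin n) (Fin n) ℝ) :=
  {X | X.IsSymm ∧ IsUnit (opW G i X)}

/-- `𝒮(i, X) = ℒ(i, X) + ℛ(i, X)ᵀ 𝒲(i, X)⁻¹ ℛ(i, X)`, meaningful for `X ∈ 𝕏ᵢ`. -/
def opS (i : Fin N) (X : Matrix (Fin n) (Fin n) ℝ) : Matrix (Fin n) (Fin n) ℝ :=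
  opL G i X + (opR G i X).transpose * (opW G i X)⁻¹ * opR G i X

variable {J : ℕ} (Pi : Fin J → Matrix (Fin N) (Fin N) ℝ)

/-- For a matrix function `Y` of `i` and `k`, the average
`Ỹ(i, k+1) = ∑ⱼ π_{ij}(ψ(k+1)) Y(j, k+1)`; it is written as a function of `i` and `k`. -/
def tildeNext (ψ : SwitchingSequence J) (Y : Fin N → ℕ → Matrix (Fin n) (Fin n) ℝ)
    (i : Fin N) (k : ℕ) : Matrix (Fin n) (Fin n) ℝ :=
  ∑ j, Pi (ψ k.succPNat) i j • Y j (k + 1)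

/-- `riccatiSteps G Pi ψ ε r i k` is obtained from the zero final condition at time `k + r` by `r`
backward steps of the perturbed Riccati recursion; see `riccati`. -/
def riccatiSteps (ψ : SwitchingSequence J) (ε : ℝ) :
    ℕ → Fin N → ℕ → Matrix (Fin n) (Fin n) ℝ
  | 0, _, _ => 0
  | r + 1, i, k =>
      opS G i (∑ j, Pi (ψ k.succPNat) i j • riccatiSteps ψ ε r j (k + 1)) + ε • 1

/-- The solution `X_ψ(i, k, T, ε)`, `0 ≤ k ≤ T + 1`, of the perturbed finite-horizon Riccati
difference equation; its defining equations are `riccati_final` and `riccati_rec`. -/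
def riccati (ψ : SwitchingSequence J) (T : ℕ) (ε : ℝ) (i : Fin N) (k : ℕ) :
    Matrix (Fin n) (Fin n) ℝ :=
  riccatiSteps G Pi ψ ε (T + 1 - k) i k

/-- Final condition `X_ψ(i, T+1, T, ε) = 0`. -/
theorem riccati_final (ψ : SwitchingSequence J) (T : ℕ) (ε : ℝ) (i : Fin N) :
    riccati G Pi ψ T ε i (T + 1) = 0 := by
  simp [riccati, riccatiSteps]

/-- Recursion `X_ψ(i, k, T, ε) = 𝒮(i, X̃_ψ(i, k+1, T, ε)) + ε I` for `0 ≤ k ≤ T`. -/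
theorem riccati_rec (ψ : SwitchingSequence J) (T : ℕ) (ε : ℝ) (i : Fin N) (k : ℕ)
    (hk : k ≤ T) :
    riccati G Pi ψ T ε i k
      = opS G i (tildeNext Pi ψ (riccati G Pi ψ T ε) i k) + ε • 1 := by
  have h : T + 1 - k = (T + 1 - (k + 1)) + 1 := by omega
  simp only [riccati, tildeNext, h, riccatiSteps]

end Operators

section Storage

variable {N n m q J : ℕ}

/-- The family `Y ψ`, `ψ ∈ Ψ`, takes positive definite values, `Y ψ i k` depends only on `i` and
on `ψ_M(k)` (the same dependence for all `ψ ∈ Ψ`), and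
`η I ≤ Y_ψ(i,k) ≤ ρ I` and `ℬ(i, Ỹ_ψ(i,k+1), Y_ψ(i,k)) ≤ -ν I` for all `ψ ∈ Ψ`, `i`, `k`. -/
def IsFiniteDependenceStorage (G : SystemMatrices N n m q)
    (Pi : Fin J → Matrix (Fin N) (Fin N) ℝ) (Ψ : Set (SwitchingSequence J))
    (η ρ ν : ℝ) (M : ℕ)
    (Y : SwitchingSequence J → Fin N → ℕ → Matrix (Fin n) (Fin n) ℝ) : Prop :=
  (∀ ψ ∈ Ψ, ∀ (i : Fin N) (k : ℕ), (Y ψ i k).PosDef) ∧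
  (∀ ψ ∈ Ψ, ∀ φ ∈ Ψ, ∀ (i : Fin N) (k t : ℕ),
    window ψ M k = window φ M t → Y ψ i k = Y φ i t) ∧
  ∀ ψ ∈ Ψ, ∀ (i : Fin N) (k : ℕ),
    η • (1 : Matrix (Fin n) (Fin n) ℝ) ≤ Y ψ i k ∧
    Y ψ i k ≤ ρ • (1 : Matrix (Fin n) (Fin n) ℝ) ∧
    kyp G i (tildeNext Pi ψ (Y ψ) i k) (Y ψ i k)
      ≤ -(ν • (1 : Matrix (Fin n ⊕ Fin m) (Fin n ⊕ Fin m) ℝ))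

end Storage

end SwitchedMJLS

end

/-! The Riccati recursion is dynamic programming for the worst-case value of the output energy plus
`ε` times the state energy minus the disturbance energy. Completion of squares gives each backward
step as a maximum over the disturbance, provided `opW` is positive definite. The proof needs bounds
on this value that do not deteriorate with the horizon, and convergence in the horizon that is
uniform in the switching sequence.

Bounds (`exists_stageCost_bound`): start the system at time `k` on the event `θ k = i` with state
`x` and disturbance `v`, then apply the worst-case gains. The total cost is `P(θ k = i)` times the
stage cost plus `ε * (x ⬝ᵥ x)`. Split the trajectory into its free and forced parts: stability
bounds the free part, strict contractivity the forced part, and the slack `1 - γ ^ 2` absorbs the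
cross terms and the perturbation `ε`. Since `P(θ k = i) > 0`, division gives the bound `ρ * (x ⬝ᵥ x)
- κ * (v ⬝ᵥ v)`. At `x = 0` it gives `opW ≥ κ`, so the next step exists; strong induction on the
number of steps then yields `exists_riccatiBound`.

Convergence (`riccati_increment_le`): for `ε < ε'` the difference of the two Riccati solutions is a
Lyapunov function of the worst-case closed loop for `ε`. It is bounded by `ρ` and loses `ε' - ε` per
step, so the increments of the solution in the horizon are dominated by a geometric sequence,
uniformly in `ψ`, `i`, `k`.

Once an increment is at most `ε / 2`, the truncated solution satisfies the dissipation inequality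
with half of the `ε`-margin left. Truncation to `M + 1` steps is what makes it depend on a window of
length `M`. -/

noncomputable section

namespace SwitchedMJLS

open Matrix

/-! ### Quadratic forms and the Loewner order -/

section Quadratic

variable {ι κ : Type*} [Fintype ι] [Fintype κ]

/-- The quadratic form `xᵀ X x`. -/
def quad (X : Matrix ι ι ℝ) (x : ι → ℝ) : ℝ := x ⬝ᵥ X *ᵥ x

theorem quad_add (X Y : Matrix ι ι ℝ) (x : ι → ℝ) : quad (X + Y) x = quad X x + quad Y x := by
  simp [quad, add_mulVec, dotProduct_add]

theorem quad_sub (X Y : Matrix ι ι ℝ) (x : ι → ℝ) : quad (X - Y) x = quad X x - quad Y x := by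
  simp [quad, sub_mulVec, dotProduct_sub]

theorem quad_neg (X : Matrix ι ι ℝ) (x : ι → ℝ) : quad (-X) x = -quad X x := by
  simp [quad, neg_mulVec]

theorem quad_smul (a : ℝ) (X : Matrix ι ι ℝ) (x : ι → ℝ) : quad (a • X) x = a * quad X x := by
  simp [quad, smul_mulVec]

@[simp]
theorem quad_zero (x : ι → ℝ) : quad (0 : Matrix ι ι ℝ) x = 0 := by simp [quad]

@[simp]
theorem quad_zero_right (X : Matrix ι ι ℝ) : quad X 0 = 0 := by simp [quad]

@[simp]
theorem quad_one [DecidableEq ι] (x : ι → ℝ) : quad (1 : Matrix ι ι ℝ) x = x ⬝ᵥ x := by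
  simp [quad]

theorem quad_sum {α : Type*} (s : Finset α) (X : α → Matrix ι ι ℝ) (x : ι → ℝ) :
    quad (∑ j ∈ s, X j) x = ∑ j ∈ s, quad (X j) x := by
  simp [quad, sum_mulVec, dotProduct_sum]

theorem quad_conj (M : Matrix ι κ ℝ) (X : Matrix ι ι ℝ) (x : κ → ℝ) :
    quad (Mᵀ * X * M) x = quad X (M *ᵥ x) := by
  simp only [quad, ← mulVec_mulVec]
  rw [dotProduct_mulVec, vecMul_transpose]

theorem quad_gram (M : Matrix ι κ ℝ) (x : κ → ℝ) :
    quad (Mᵀ * M) x = (M *ᵥ x) ⬝ᵥ (M *ᵥ x) := by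
  simp only [quad, ← mulVec_mulVec]
  rw [dotProduct_mulVec, vecMul_transpose]

theorem quad_add_right {X : Matrix ι ι ℝ} (hX : X.IsSymm) (x y : ι → ℝ) :
    quad X (x + y) = quad X x + 2 * (y ⬝ᵥ X *ᵥ x) + quad X y := by
  have : x ⬝ᵥ X *ᵥ y = y ⬝ᵥ X *ᵥ x := by
    rw [dotProduct_mulVec, ← mulVec_transpose, hX.eq, dotProduct_comm]
  simp only [quad, mulVec_add, dotProduct_add, add_dotProduct, this]
  ring

theorem quad_sub_right {X : Matrix ι ι ℝ} (hX : X.IsSymm) (x y : ι → ℝ) :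
    quad X (x - y) = quad X x - 2 * (x ⬝ᵥ X *ᵥ y) + quad X y := by
  have : y ⬝ᵥ X *ᵥ x = x ⬝ᵥ X *ᵥ y := by
    rw [dotProduct_mulVec, ← mulVec_transpose, hX.eq, dotProduct_comm]
  simp only [quad, mulVec_sub, dotProduct_sub, sub_dotProduct, this]
  ring

theorem dotProduct_self_nonneg' (x : ι → ℝ) : 0 ≤ x ⬝ᵥ x :=
  Finset.sum_nonneg fun i _ => mul_self_nonneg (x i)

theorem le_of_quad_le {X Y : Matrix ι ι ℝ} (hX : X.IsSymm) (hY : Y.IsSymm)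
    (h : ∀ x, quad X x ≤ quad Y x) : X ≤ Y := by
  rw [Matrix.le_iff, posSemidef_iff_dotProduct_mulVec]
  refine ⟨?_, fun x => ?_⟩
  · rw [Matrix.IsHermitian, conjTranspose_eq_transpose_of_trivial, transpose_sub, hX.eq, hY.eq]
  · have := quad_sub Y X x
    rw [star_trivial]
    change 0 ≤ quad (Y - X) x
    linarith [h x]

theorem quad_le_of_le {X Y : Matrix ι ι ℝ} (h : X ≤ Y) (x : ι → ℝ) : quad X x ≤ quad Y x := by
  rw [Matrix.le_iff, posSemidef_iff_dotProduct_mulVec] at h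
  have h1 := h.2 x
  rw [star_trivial] at h1
  have := quad_sub Y X x
  change 0 ≤ quad (Y - X) x at h1
  linarith

theorem posDef_of_quad {X : Matrix ι ι ℝ} (hX : X.IsSymm) {a : ℝ} (ha : 0 < a)
    (h : ∀ x, a * (x ⬝ᵥ x) ≤ quad X x) : X.PosDef := by
  rw [posDef_iff_dotProduct_mulVec]
  refine ⟨?_, fun x hx => ?_⟩
  · rw [Matrix.IsHermitian, conjTranspose_eq_transpose_of_trivial, hX.eq]
  · rw [star_trivial]
    refine lt_of_lt_of_le (mul_pos ha ?_) (h x)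
    exact lt_of_le_of_ne (dotProduct_self_nonneg' x) fun h => hx (dotProduct_self_eq_zero.1 h.symm)

/-- Young's inequality for a positive semidefinite quadratic form. -/
theorem quad_add_right_le {X : Matrix ι ι ℝ} (hX : X.IsSymm) (h : ∀ x, 0 ≤ quad X x) {δ : ℝ}
    (hδ : 0 < δ) (x y : ι → ℝ) :
    quad X (x + y) ≤ (1 + δ) * quad X x + (1 + δ⁻¹) * quad X y := by
  have h1 := h (δ • x - y)
  rw [quad_sub_right hX] at h1
  have h2 : quad X (δ • x) = δ ^ 2 * quad X x := by
    simp [quad, mulVec_smul]; ring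
  have h3 : (δ • x) ⬝ᵥ X *ᵥ y = δ * (y ⬝ᵥ X *ᵥ x) := by
    rw [smul_dotProduct, dotProduct_mulVec, ← mulVec_transpose, hX.eq, dotProduct_comm,
      smul_eq_mul]
  rw [quad_add_right hX]
  rw [h2, h3] at h1
  have h4 : 0 ≤ δ⁻¹ * (δ ^ 2 * quad X x - 2 * (δ * (y ⬝ᵥ X *ᵥ x)) + quad X y) :=
    mul_nonneg (inv_nonneg.2 hδ.le) h1
  have h5 : δ⁻¹ * (δ ^ 2 * quad X x - 2 * (δ * (y ⬝ᵥ X *ᵥ x)) + quad X y)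
      = δ * quad X x - 2 * (y ⬝ᵥ X *ᵥ x) + δ⁻¹ * quad X y := by
    field_simp
  rw [h5] at h4
  linarith

theorem dotProduct_self_add_le {δ : ℝ} (hδ : 0 < δ) (x y : ι → ℝ) :
    (x + y) ⬝ᵥ (x + y) ≤ (1 + δ) * (x ⬝ᵥ x) + (1 + δ⁻¹) * (y ⬝ᵥ y) := by
  classical
  simpa using quad_add_right_le (X := (1 : Matrix ι ι ℝ)) isSymm_one
    (fun x => by simpa using dotProduct_self_nonneg' x) hδ x y

/-- A finite family of matrices is uniformly bounded as a family of operators. -/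
theorem exists_mulVec_bound {α : Type*} [Finite α] (M : α → Matrix ι κ ℝ) :
    ∃ b : ℝ, 0 ≤ b ∧ ∀ a x, (M a *ᵥ x) ⬝ᵥ (M a *ᵥ x) ≤ b * (x ⬝ᵥ x) := by
  have := Fintype.ofFinite α
  refine ⟨∑ a, ∑ i, (M a i) ⬝ᵥ (M a i), Finset.sum_nonneg fun a _ => Finset.sum_nonneg fun i _ =>
    dotProduct_self_nonneg' _, fun a x => ?_⟩
  have h1 : (M a *ᵥ x) ⬝ᵥ (M a *ᵥ x) ≤ (∑ i, (M a i) ⬝ᵥ (M a i)) * (x ⬝ᵥ x) := by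
    rw [Finset.sum_mul]
    refine Finset.sum_le_sum fun i _ => ?_
    have := Finset.sum_mul_sq_le_sq_mul_sq Finset.univ (M a i) x
    simp only [mulVec, dotProduct, ← pow_two]
    exact this
  refine h1.trans (mul_le_mul_of_nonneg_right ?_ (dotProduct_self_nonneg' x))
  exact Finset.single_le_sum (f := fun a => ∑ i, (M a i) ⬝ᵥ (M a i))
    (fun a _ => Finset.sum_nonneg fun i _ => dotProduct_self_nonneg' _) (Finset.mem_univ a)

end Quadratic

/-! ### One-step cost and completion of squares -/

section StageCost

variable {N n m q : ℕ} (G : SystemMatrices N n m q)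

/-- The cost `xᵀ₊ X x₊ + ‖z‖² - ‖v‖²` of one step in mode `i` from `x` with disturbance `v`. -/
def stageCost (i : Fin N) (X : Matrix (Fin n) (Fin n) ℝ) (x : Fin n → ℝ) (v : Fin m → ℝ) : ℝ :=
  quad X (G.A i *ᵥ x + G.B i *ᵥ v)
    + (G.C i *ᵥ x + G.D i *ᵥ v) ⬝ᵥ (G.C i *ᵥ x + G.D i *ᵥ v) - v ⬝ᵥ v

theorem opW_isSymm (i : Fin N) {X : Matrix (Fin n) (Fin n) ℝ} (hX : X.IsSymm) :
    (opW G i X).IsSymm := by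
  simp [Matrix.IsSymm, opW, transpose_sub, transpose_mul, hX.eq, Matrix.mul_assoc]

theorem opS_isSymm (i : Fin N) {X : Matrix (Fin n) (Fin n) ℝ} (hX : X.IsSymm) :
    (opS G i X).IsSymm := by
  simp [Matrix.IsSymm, opS, opL, transpose_mul, hX.eq, Matrix.mul_assoc,
    transpose_nonsing_inv, (opW_isSymm G i hX).eq]

theorem stageCost_eq (i : Fin N) {X : Matrix (Fin n) (Fin n) ℝ} (hX : X.IsSymm)
    (x : Fin n → ℝ) (v : Fin m → ℝ) :
    stageCost G i X x v
      = quad (opL G i X) x + 2 * (v ⬝ᵥ opR G i X *ᵥ x) - quad (opW G i X) v := by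
  have h1 : ∀ {a b : ℕ} (M : Matrix (Fin a) (Fin b) ℝ) (y : Fin b → ℝ) (z : Fin a → ℝ),
      (M *ᵥ y) ⬝ᵥ z = y ⬝ᵥ Mᵀ *ᵥ z := fun M y z => by
    rw [dotProduct_mulVec, vecMul_transpose]
  have h2 : (G.C i *ᵥ x + G.D i *ᵥ v) ⬝ᵥ (G.C i *ᵥ x + G.D i *ᵥ v)
      = quad (1 : Matrix (Fin q) (Fin q) ℝ) (G.C i *ᵥ x + G.D i *ᵥ v) := by simp
  rw [stageCost, h2, quad_add_right hX, quad_add_right isSymm_one, opL, opW, quad_add, quad_sub,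
    quad_sub, quad_conj, quad_conj, quad_gram, quad_gram, opR, add_mulVec, dotProduct_add, h1, h1]
  simp only [one_mulVec, quad_one, ← mulVec_mulVec]
  ring

/-- Completion of squares. -/
theorem stageCost_eq_opS (i : Fin N) {X : Matrix (Fin n) (Fin n) ℝ} (hX : X.IsSymm)
    (hW : IsUnit (opW G i X)) (x : Fin n → ℝ) (v : Fin m → ℝ) :
    stageCost G i X x v = quad (opS G i X) x
      - quad (opW G i X) (v - ((opW G i X)⁻¹ * opR G i X) *ᵥ x) := by
  have hdet : IsUnit (opW G i X).det := (isUnit_iff_isUnit_det _).1 hW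
  rw [stageCost_eq G i hX, quad_sub_right (opW_isSymm G i hX), opS, quad_add]
  have h1 : opW G i X *ᵥ (((opW G i X)⁻¹ * opR G i X) *ᵥ x) = opR G i X *ᵥ x := by
    rw [mulVec_mulVec, ← Matrix.mul_assoc, mul_nonsing_inv _ hdet, Matrix.one_mul]
  have h2 : quad (opW G i X) (((opW G i X)⁻¹ * opR G i X) *ᵥ x)
      = quad ((opR G i X)ᵀ * (opW G i X)⁻¹ * opR G i X) x := by
    rw [quad_conj, quad, h1, ← mulVec_mulVec, dotProduct_comm, quad]
  rw [h1, h2]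
  ring

/-- The completed square enters with a minus sign, so `opS` dominates the cost of every disturbance;
`stageCost_gain` shows that the bound is attained. -/
theorem stageCost_le_opS (i : Fin N) {X : Matrix (Fin n) (Fin n) ℝ} (hX : X.IsSymm)
    (hW : IsUnit (opW G i X)) (hW0 : ∀ v, 0 ≤ quad (opW G i X) v) (x : Fin n → ℝ)
    (v : Fin m → ℝ) : stageCost G i X x v ≤ quad (opS G i X) x := by
  rw [stageCost_eq_opS G i hX hW]
  linarith [hW0 (v - ((opW G i X)⁻¹ * opR G i X) *ᵥ x)]

theorem stageCost_gain (i : Fin N) {X : Matrix (Fin n) (Fin n) ℝ} (hX : X.IsSymm)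
    (hW : IsUnit (opW G i X)) (x : Fin n → ℝ) :
    stageCost G i X x (((opW G i X)⁻¹ * opR G i X) *ᵥ x) = quad (opS G i X) x := by
  rw [stageCost_eq_opS G i hX hW]; simp

/-- Turns an upper bound on the stage cost at the zero state into a lower bound on `opW`, hence into
invertibility. -/
theorem stageCost_zero_left (i : Fin N) {X : Matrix (Fin n) (Fin n) ℝ} (hX : X.IsSymm)
    (v : Fin m → ℝ) : stageCost G i X 0 v = -quad (opW G i X) v := by
  rw [stageCost_eq G i hX]; simp

theorem stageCost_zero_right_nonneg (i : Fin N) {X : Matrix (Fin n) (Fin n) ℝ}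
    (hX0 : ∀ x, 0 ≤ quad X x) (x : Fin n → ℝ) : 0 ≤ stageCost G i X x 0 := by
  simp only [stageCost, mulVec_zero, add_zero, dotProduct_zero, sub_zero]
  exact add_nonneg (hX0 _) (dotProduct_self_nonneg' _)

theorem stageCost_sub (i : Fin N) (X Y : Matrix (Fin n) (Fin n) ℝ)
    (x : Fin n → ℝ) (v : Fin m → ℝ) :
    stageCost G i X x v - stageCost G i Y x v = quad (X - Y) (G.A i *ᵥ x + G.B i *ᵥ v) := by
  rw [quad_sub, stageCost, stageCost]; ring

/-- Reduces the block matrix inequality to a dissipation inequality for the stage cost. -/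
theorem quad_kyp (i : Fin N) (X Y : Matrix (Fin n) (Fin n) ℝ) (u : Fin n ⊕ Fin m → ℝ) :
    quad (kyp G i X Y) u
      = stageCost G i X (u ∘ Sum.inl) (u ∘ Sum.inr) - quad Y (u ∘ Sum.inl) := by
  rw [kyp, quad_sub, quad_conj, fromBlocks_mulVec]
  simp only [quad, fromBlocks_mulVec, stageCost, Sum.elim_comp_inl, Sum.elim_comp_inr,
    zero_mulVec, one_mulVec, add_zero, zero_add, sumElim_dotProduct_sumElim]
  have : u ⬝ᵥ Sum.elim (Y *ᵥ (u ∘ Sum.inl)) (u ∘ Sum.inr)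
      = (u ∘ Sum.inl) ⬝ᵥ Y *ᵥ (u ∘ Sum.inl) + (u ∘ Sum.inr) ⬝ᵥ (u ∘ Sum.inr) := by
    rw [← sumElim_dotProduct_sumElim, Sum.elim_comp_inl_inr]
  rw [this]
  ring

theorem kyp_isSymm (i : Fin N) {X Y : Matrix (Fin n) (Fin n) ℝ} (hX : X.IsSymm)
    (hY : Y.IsSymm) : (kyp G i X Y).IsSymm := by
  simp only [Matrix.IsSymm, kyp, transpose_sub, transpose_mul, fromBlocks_transpose, hX.eq, hY.eq,
    transpose_transpose, transpose_one, transpose_zero, Matrix.mul_assoc]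

end StageCost

end SwitchedMJLS

end

noncomputable section

namespace SwitchedMJLS

open Matrix

/-! ### Expectations of functionals of finitely many modes -/

section Markov

variable {Ω : Type*} [MeasurableSpace Ω] {P : Measure Ω} [IsProbabilityMeasure P] {N : ℕ}
  {θ : ℕ → Ω → Fin N} {p₀ : Fin N → ℝ} {T : ℕ+ → Matrix (Fin N) (Fin N) ℝ}

/-- Extension of a history of length `t + 1` to an infinite path. -/
def extendPath {t : ℕ} (h : Fin (t + 1) → Fin N) : ℕ → Fin N :=
  fun l => h ⟨min l t, by omega⟩

/-- There are finitely many histories up to time `t`, so such a functional factors through a finite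
type. Measurability and integrability below come from this. -/
theorem eq_extendPath_of_dependsOn {β : Type*} {t : ℕ} {F : (ℕ → Fin N) → β}
    (hF : DependsOn F (Set.Iic t)) (p : ℕ → Fin N) :
    F p = F (extendPath fun l : Fin (t + 1) => p l) := by
  refine hF fun l hl => ?_
  simp [extendPath, min_eq_left (Set.mem_Iic.1 hl)]

theorem measurable_history (hθ : ∀ k, Measurable (θ k)) (t : ℕ) :
    Measurable fun ω => fun l : Fin (t + 1) => θ l ω :=
  measurable_pi_lambda _ fun l => hθ l

theorem measurable_of_dependsOn {β : Type*} [MeasurableSpace β] (hθ : ∀ k, Measurable (θ k))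
    {t : ℕ} {F : (ℕ → Fin N) → β} (hF : DependsOn F (Set.Iic t)) :
    Measurable fun ω => F (fun l => θ l ω) := by
  have : (fun ω => F (fun l => θ l ω))
      = (fun h : Fin (t + 1) → Fin N => F (extendPath h)) ∘
        fun ω => fun l : Fin (t + 1) => θ l ω := by
    funext ω; exact eq_extendPath_of_dependsOn hF _
  rw [this]
  exact (measurable_of_finite _).comp (measurable_history hθ t)

theorem integrable_of_dependsOn (hθ : ∀ k, Measurable (θ k))
    {t : ℕ} {F : (ℕ → Fin N) → ℝ} (hF : DependsOn F (Set.Iic t)) :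
    Integrable (fun ω => F (fun l => θ l ω)) P := by
  refine Integrable.of_bound (measurable_of_dependsOn hθ hF).aestronglyMeasurable
    (∑ h : Fin (t + 1) → Fin N, ‖F (extendPath h)‖) (Filter.Eventually.of_forall fun ω => ?_)
  rw [eq_extendPath_of_dependsOn hF]
  exact Finset.single_le_sum (f := fun h : Fin (t + 1) → Fin N => ‖F (extendPath h)‖)
    (fun h _ => norm_nonneg _) (Finset.mem_univ _)

/-- Both sides become finite sums over histories after passing to the image laws, and the product
form of the Markov property matches them term by term. No conditional expectation is needed. -/
theorem IsMarkovChain.integral_next (hM : IsMarkovChain P θ p₀ T) {t : ℕ}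
    {F : (ℕ → Fin N) → Fin N → ℝ} (hF : DependsOn F (Set.Iic t)) :
    ∫ ω, F (fun l => θ l ω) (θ (t + 1) ω) ∂P
      = ∫ ω, ∑ j, T t.succPNat (θ t ω) j * F (fun l => θ l ω) j ∂P := by
  have hm := measurable_history hM.1 t
  have hm' : Measurable fun ω => ((fun l : Fin (t + 1) => θ l ω), θ (t + 1) ω) :=
    hm.prodMk (hM.1 (t + 1))
  have h1 : ∫ ω, F (fun l => θ l ω) (θ (t + 1) ω) ∂P
      = ∫ y, F (extendPath y.1) y.2 ∂(P.map fun ω => ((fun l : Fin (t + 1) => θ l ω), θ (t + 1) ω)) := by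
    rw [integral_map hm'.aemeasurable (measurable_of_finite _).aestronglyMeasurable]
    refine integral_congr_ae (Filter.Eventually.of_forall fun ω => ?_)
    simp only
    rw [eq_extendPath_of_dependsOn hF]
  have h2 : ∫ ω, ∑ j, T t.succPNat (θ t ω) j * F (fun l => θ l ω) j ∂P
      = ∫ y, ∑ j, T t.succPNat (extendPath y t) j * F (extendPath y) j
          ∂(P.map fun ω => fun l : Fin (t + 1) => θ l ω) := by
    rw [integral_map hm.aemeasurable (measurable_of_finite _).aestronglyMeasurable]
    refine integral_congr_ae (Filter.Eventually.of_forall fun ω => ?_)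
    simp only
    rw [eq_extendPath_of_dependsOn hF]
    simp [extendPath]
  have : IsProbabilityMeasure
      (P.map fun ω => ((fun l : Fin (t + 1) => θ l ω), θ (t + 1) ω)) :=
    Measure.isProbabilityMeasure_map hm'.aemeasurable
  have : IsProbabilityMeasure (P.map fun ω => fun l : Fin (t + 1) => θ l ω) :=
    Measure.isProbabilityMeasure_map hm.aemeasurable
  rw [h1, h2, integral_fintype (Integrable.of_finite), integral_fintype (Integrable.of_finite),
    Fintype.sum_prod_type]
  refine Finset.sum_congr rfl fun h _ => ?_
  rw [smul_eq_mul, Finset.mul_sum]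
  refine Finset.sum_congr rfl fun j _ => ?_
  have h3 := hM.2.2 t (fun l => if l ≤ t then extendPath h l else j)
  have h4 : (P.map fun ω => ((fun l : Fin (t + 1) => θ l ω), θ (t + 1) ω)).real {(h, j)}
      = P.real {ω | ∀ l ≤ t + 1, θ l ω = if l ≤ t then extendPath h l else j} := by
    rw [map_measureReal_apply hm' (measurableSet_singleton _)]
    congr 1
    ext ω
    simp only [Set.mem_preimage, Set.mem_singleton_iff, Prod.mk.injEq, Set.mem_ofPred_eq]
    constructor
    · rintro ⟨rfl, rfl⟩ l hl
      split_ifs with hlt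
      · simp [extendPath, min_eq_left hlt]
      · rw [show l = t + 1 by omega]
    · intro H
      refine ⟨funext fun l => ?_, by simpa using H (t + 1) le_rfl⟩
      have hl : (l : ℕ) ≤ t := by omega
      rw [H l (by omega), if_pos hl]
      simp [extendPath, min_eq_left hl]
  have h5 : (P.map fun ω => fun l : Fin (t + 1) => θ l ω).real {h}
      = P.real {ω | ∀ l ≤ t, θ l ω = if l ≤ t then extendPath h l else j} := by
    rw [map_measureReal_apply hm (measurableSet_singleton _)]
    congr 1
    ext ω
    simp only [Set.mem_preimage, Set.mem_singleton_iff, Set.mem_ofPred_eq]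
    constructor
    · rintro rfl l hl
      simp [extendPath, hl]
    · intro H
      refine funext fun l => ?_
      have hl : (l : ℕ) ≤ t := by omega
      rw [H l hl, if_pos hl]
      simp [extendPath, min_eq_left hl]
  rw [h4, h3, h5]
  simp [mul_assoc]

/-- The average `E[Q(θ(k+1)) | θ(k) = i]` of a matrix function `Q` of the mode. -/
def modeAverage {n : ℕ} (p : Matrix (Fin N) (Fin N) ℝ) (Q : Fin N → Matrix (Fin n) (Fin n) ℝ)
    (i : Fin N) : Matrix (Fin n) (Fin n) ℝ := ∑ j, p i j • Q j

theorem quad_modeAverage {n : ℕ} (p : Matrix (Fin N) (Fin N) ℝ)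
    (Q : Fin N → Matrix (Fin n) (Fin n) ℝ) (i : Fin N) (x : Fin n → ℝ) :
    quad (modeAverage p Q i) x = ∑ j, p i j * quad (Q j) x := by
  simp [modeAverage, quad_sum, quad_smul]

theorem IsMarkovChain.integral_quad_next (hM : IsMarkovChain P θ p₀ T) {n t : ℕ}
    {x : (ℕ → Fin N) → Fin n → ℝ} (hx : DependsOn x (Set.Iic t))
    (Q : Fin N → Matrix (Fin n) (Fin n) ℝ) :
    ∫ ω, quad (Q (θ (t + 1) ω)) (x fun l => θ l ω) ∂P
      = ∫ ω, quad (modeAverage (T t.succPNat) Q (θ t ω)) (x fun l => θ l ω) ∂P := by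
  simp only [quad_modeAverage]
  exact hM.integral_next (F := fun p j => quad (Q j) (x p))
    fun p p' h => by simp only; rw [hx h]

section Average

variable {p : Matrix (Fin N) (Fin N) ℝ} {n : ℕ}

theorem modeAverage_isSymm {Q : Fin N → Matrix (Fin n) (Fin n) ℝ} (hQ : ∀ j, (Q j).IsSymm)
    (i : Fin N) : (modeAverage p Q i).IsSymm := by
  simp only [Matrix.IsSymm, modeAverage, transpose_sum, transpose_smul, (hQ _).eq]

theorem quad_modeAverage_nonneg (hp : p ∈ rowStochastic ℝ (Fin N))
    {Q : Fin N → Matrix (Fin n) (Fin n) ℝ} {x : Fin n → ℝ} (h : ∀ j, 0 ≤ quad (Q j) x)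
    (i : Fin N) : 0 ≤ quad (modeAverage p Q i) x := by
  rw [quad_modeAverage]
  exact Finset.sum_nonneg fun j _ => mul_nonneg (hp.1 i j) (h j)

theorem quad_modeAverage_le (hp : p ∈ rowStochastic ℝ (Fin N))
    {Q : Fin N → Matrix (Fin n) (Fin n) ℝ} {x : Fin n → ℝ} {b : ℝ} (h : ∀ j, quad (Q j) x ≤ b)
    (i : Fin N) : quad (modeAverage p Q i) x ≤ b := by
  rw [quad_modeAverage]
  calc _ ≤ ∑ j, p i j * b :=
        Finset.sum_le_sum fun j _ => mul_le_mul_of_nonneg_left (h j) (hp.1 i j)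
    _ = b := by rw [← Finset.sum_mul, sum_row_of_mem_rowStochastic hp, one_mul]

end Average

omit [IsProbabilityMeasure P] in
theorem integral_indicator_mode (hθ : ∀ k, Measurable (θ k)) (k : ℕ) (i : Fin N) (a : ℝ) :
    ∫ ω, (if θ k ω = i then a else 0) ∂P = P.real {ω | θ k ω = i} * a := by
  have hs : MeasurableSet {ω | θ k ω = i} := hθ k (measurableSet_singleton i)
  have : (fun ω => if θ k ω = i then a else 0) = {ω | θ k ω = i}.indicator fun _ => a := by
    funext ω; simp [Set.indicator_apply]
  rw [this, integral_indicator_const a hs, smul_eq_mul]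

end Markov

end SwitchedMJLS

end

noncomputable section

namespace SwitchedMJLS

open Matrix

/-! ### Nonanticipative trajectories -/

section Driven

variable {N n m q J : ℕ} (G : SystemMatrices N n m q)

/-- `x` is a nonanticipative trajectory, started at time `k` and driven by the nonanticipative
disturbance `w`; the index `s` of `x s` and `w s` counts the steps made since time `k`. -/
structure IsDriven (k : ℕ) (x : ℕ → (ℕ → Fin N) → Fin n → ℝ)
    (w : ℕ → (ℕ → Fin N) → Fin m → ℝ) : Prop where
  init : DependsOn (x 0) (Set.Iic k)
  input : ∀ s, DependsOn (w s) (Set.Iic (k + s))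
  step : ∀ s p, x (s + 1) p = G.A (p (k + s)) *ᵥ x s p + G.B (p (k + s)) *ᵥ w s p

variable {G}
variable {k : ℕ} {x : ℕ → (ℕ → Fin N) → Fin n → ℝ} {w : ℕ → (ℕ → Fin N) → Fin m → ℝ}

theorem IsDriven.dependsOn_succ_of (h : IsDriven G k x w) {s : ℕ}
    (hs : DependsOn (x s) (Set.Iic (k + s))) : DependsOn (x (s + 1)) (Set.Iic (k + s)) := by
  intro p p' hp
  rw [h.step, h.step, hs hp, h.input s hp, hp (k + s) (Set.mem_Iic.2 le_rfl)]

theorem IsDriven.dependsOn (h : IsDriven G k x w) (s : ℕ) :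
    DependsOn (x s) (Set.Iic (k + s)) := by
  induction s with
  | zero => exact h.init
  | succ s ih =>
    intro p p' hp
    exact h.dependsOn_succ_of ih fun l hl => hp l (Set.mem_Iic.2 (by
      have := Set.mem_Iic.1 hl; omega))

/-- The state at step `s + 1` is already determined by the modes up to `k + s`. This is what allows
averaging over the mode at time `k + s + 1` with the state held fixed. -/
theorem IsDriven.dependsOn_succ (h : IsDriven G k x w) (s : ℕ) :
    DependsOn (x (s + 1)) (Set.Iic (k + s)) :=
  h.dependsOn_succ_of (h.dependsOn s)

theorem dependsOn_quad {t s : ℕ} (hs : s ≤ t) {y : (ℕ → Fin N) → Fin n → ℝ}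
    (hy : DependsOn y (Set.Iic t)) (Q : Fin N → Matrix (Fin n) (Fin n) ℝ) :
    DependsOn (fun p => quad (Q (p s)) (y p)) (Set.Iic t) := by
  intro p p' hp
  simp only
  rw [hy hp, hp s (Set.mem_Iic.2 hs)]

theorem dependsOn_normSq {t : ℕ} {y : (ℕ → Fin N) → Fin n → ℝ}
    (hy : DependsOn y (Set.Iic t)) : DependsOn (fun p => y p ⬝ᵥ y p) (Set.Iic t) := by
  intro p p' hp
  simp only
  rw [hy hp]

variable {Ω : Type*} [MeasurableSpace Ω] {P : Measure Ω} [IsProbabilityMeasure P]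
  {θ : ℕ → Ω → Fin N} {p₀ : Fin N → ℝ} {T : ℕ+ → Matrix (Fin N) (Fin N) ℝ}

theorem IsDriven.integral_quad_succ (h : IsDriven G k x w) (hM : IsMarkovChain P θ p₀ T)
    (Q : Fin N → Matrix (Fin n) (Fin n) ℝ) (s : ℕ) :
    ∫ ω, quad (Q (θ (k + (s + 1)) ω)) (x (s + 1) fun l => θ l ω) ∂P
      = ∫ ω, quad (modeAverage (T (k + s).succPNat) Q (θ (k + s) ω))
          (G.A (θ (k + s) ω) *ᵥ x s (fun l => θ l ω)
            + G.B (θ (k + s) ω) *ᵥ w s (fun l => θ l ω)) ∂P := by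
  rw [← Nat.add_assoc, hM.integral_quad_next (h.dependsOn_succ s)]
  simp only [h.step]

end Driven

/-! ### Free motion and the meaning of the stability hypothesis -/

section FreeMotion

variable {N n m q J : ℕ} (G : SystemMatrices N n m q) (Pi : Fin J → Matrix (Fin N) (Fin N) ℝ)

/-- `E[Φ(k+s,k)ᵀ Φ(k+s,k) | θ(k) = i]`, computed by the backward recursion. -/
def freeGram (ψ : SwitchingSequence J) : ℕ → Fin N → ℕ → Matrix (Fin n) (Fin n) ℝ
  | 0, _, _ => 1
  | s + 1, i, k => (G.A i)ᵀ
      * modeAverage (Pi (ψ k.succPNat)) (fun j => freeGram ψ s j (k + 1)) i * G.A i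

theorem freeGram_isSymm (ψ : SwitchingSequence J) (s : ℕ) (i : Fin N) (k : ℕ) :
    (freeGram G Pi ψ s i k).IsSymm := by
  induction s generalizing i k with
  | zero => exact isSymm_one
  | succ s ih =>
    have := modeAverage_isSymm (p := Pi (ψ k.succPNat)) (fun j => ih j (k + 1)) i
    simp [Matrix.IsSymm, freeGram, transpose_mul, this.eq, Matrix.mul_assoc]

theorem freeGram_nonneg (hPi : ∀ s, Pi s ∈ rowStochastic ℝ (Fin N)) (ψ : SwitchingSequence J)
    (s : ℕ) (i : Fin N) (k : ℕ) (x : Fin n → ℝ) : 0 ≤ quad (freeGram G Pi ψ s i k) x := by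
  induction s generalizing i k x with
  | zero => simpa [freeGram] using dotProduct_self_nonneg' x
  | succ s ih =>
    rw [freeGram, quad_conj]
    exact quad_modeAverage_nonneg (hPi _) (fun j => ih j (k + 1) _) i

variable {G Pi}
variable {Ω : Type*} [MeasurableSpace Ω] {P : Measure Ω} [IsProbabilityMeasure P]
  {θ : ℕ → Ω → Fin N} {p₀ : Fin N → ℝ} {ψ : SwitchingSequence J}

theorem integral_freeGram {k : ℕ} {x : ℕ → (ℕ → Fin N) → Fin n → ℝ} (h : IsDriven G k x 0)
    (hM : IsMarkovChain P θ p₀ fun k => Pi (ψ k)) (s u : ℕ) :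
    ∫ ω, quad (freeGram G Pi ψ s (θ (k + u) ω) (k + u)) (x u fun l => θ l ω) ∂P
      = ∫ ω, (x (u + s) fun l => θ l ω) ⬝ᵥ (x (u + s) fun l => θ l ω) ∂P := by
  induction s generalizing u with
  | zero => simp [freeGram]
  | succ s ih =>
    have h1 := ih (u + 1)
    rw [h.integral_quad_succ hM (fun j => freeGram G Pi ψ s j (k + (u + 1))) u] at h1
    rw [show u + (s + 1) = u + 1 + s by omega, ← h1]
    simp only [freeGram, quad_conj, _root_.Pi.zero_apply, mulVec_zero, add_zero, Nat.add_assoc]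

theorem transition_self (path : ℕ → Fin N) (k : ℕ) : transition G path k k = 1 := by
  cases k <;> simp [transition]

theorem transition_succ (path : ℕ → Fin N) (k u : ℕ) :
    transition G path (k + (u + 1)) k = G.A (path (k + u)) * transition G path (k + u) k := by
  rw [← Nat.add_assoc, transition, if_pos (Nat.le_add_right k u)]

/-- The event `p k = i` belongs to the history at time `k`, so conditioning on it is replaced by
starting from `x₀` on it and from zero elsewhere. -/
theorem isDriven_transition (k : ℕ) (i : Fin N) (x₀ : Fin n → ℝ) :
    IsDriven G k (fun u p => if p k = i then transition G p (k + u) k *ᵥ x₀ else 0) 0 where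
  init := by
    intro p p' hp
    simp only [Nat.add_zero, transition_self, hp k (Set.mem_Iic.2 le_rfl)]
  input _ _ _ _ := rfl
  step s p := by
    simp only [transition_succ]
    split_ifs <;> simp

theorem quad_condExpect {t : ℕ} {i : Fin N} (hθ : ∀ k, Measurable (θ k)) {k : ℕ}
    (hpos : 0 < P.real {ω | θ k ω = i}) {F : (ℕ → Fin N) → Matrix (Fin n) (Fin n) ℝ}
    (hF : DependsOn F (Set.Iic t)) (x : Fin n → ℝ) :
    P.real {ω | θ k ω = i} * quad (condExpect P (θ k) i fun ω => F fun l => θ l ω) x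
      = ∫ ω, (if θ k ω = i then quad (F fun l => θ l ω) x else 0) ∂P := by
  have hs : MeasurableSet {ω | θ k ω = i} := hθ k (measurableSet_singleton i)
  have hne : P {ω | θ k ω = i} ≠ 0 := by
    intro h
    simp [Measure.real, h] at hpos
  have := ProbabilityTheory.cond_isProbabilityMeasure hne
  have h1 : quad (condExpect P (θ k) i fun ω => F fun l => θ l ω) x
      = ∫ ω, quad (F fun l => θ l ω) x ∂(ProbabilityTheory.cond P {ω | θ k ω = i}) := by
    have hint : ∀ a b, Integrable (fun ω => x a * ((F fun l => θ l ω) a b * x b))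
        (ProbabilityTheory.cond P {ω | θ k ω = i}) := fun a b =>
      integrable_of_dependsOn hθ (t := t) (F := fun p => x a * (F p a b * x b))
        fun p p' hp => by simp only; rw [hF hp]
    simp only [quad, dotProduct, mulVec, condExpect, Matrix.of_apply, Finset.mul_sum]
    rw [integral_finsetSum _ fun a _ => integrable_finsetSum _ fun b _ => hint a b]
    refine Finset.sum_congr rfl fun a _ => ?_
    rw [integral_finsetSum _ fun b _ => hint a b]
    refine Finset.sum_congr rfl fun b _ => ?_
    rw [integral_const_mul, integral_mul_const]
  have h2 : (fun ω => if θ k ω = i then quad (F fun l => θ l ω) x else 0)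
      = {ω | θ k ω = i}.indicator fun ω => quad (F fun l => θ l ω) x := by
    funext ω; simp [Set.indicator_apply]
  rw [h1, h2, integral_indicator hs, ProbabilityTheory.cond, integral_smul_measure,
    ENNReal.toReal_inv, smul_eq_mul, ← mul_assoc]
  rw [Measure.real] at hpos ⊢
  rw [mul_inv_cancel₀ hpos.ne', one_mul]

/-- Along the trajectory of `isDriven_transition`, the energy after `s` steps is `P(θ k = i)` times
both the form of `freeGram` and that of the conditional Gram matrix. Positivity of the probability
permits cancellation, so the stability estimate passes to the recursion. -/
theorem freeGram_le {c lam : ℝ} (hM : IsMarkovChain P θ p₀ fun k => Pi (ψ k))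
    (hpos : ∀ (i : Fin N) (k : ℕ), 0 < P.real {ω | θ k ω = i})
    (hstab : ∀ (i : Fin N) (k j : ℕ), j ≤ k →
      condExpect P (θ j) i (fun ω =>
          (transition G (fun l => θ l ω) k j).transpose * transition G (fun l => θ l ω) k j)
        ≤ (c * lam ^ (k - j)) • (1 : Matrix (Fin n) (Fin n) ℝ))
    (s : ℕ) (i : Fin N) (k : ℕ) (x : Fin n → ℝ) :
    quad (freeGram G Pi ψ s i k) x ≤ c * lam ^ s * (x ⬝ᵥ x) := by
  have hdr := isDriven_transition (G := G) k i x
  have h1 := integral_freeGram hdr hM s 0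
  have h2 : ∀ ω, quad (freeGram G Pi ψ s (θ (k + 0) ω) (k + 0))
      (if θ k ω = i then transition G (fun l => θ l ω) (k + 0) k *ᵥ x else 0)
      = if θ k ω = i then quad (freeGram G Pi ψ s i k) x else 0 := fun ω => by
    split_ifs with h
    · simp [transition_self, h]
    · simp
  simp only [h2] at h1
  rw [integral_indicator_mode hM.1] at h1
  have h3 : ∀ ω, (if θ k ω = i then transition G (fun l => θ l ω) (k + (0 + s)) k *ᵥ x else 0) ⬝ᵥ
      (if θ k ω = i then transition G (fun l => θ l ω) (k + (0 + s)) k *ᵥ x else 0)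
      = if θ k ω = i then quad ((transition G (fun l => θ l ω) (k + s) k)ᵀ
          * transition G (fun l => θ l ω) (k + s) k) x else 0 := fun ω => by
    rw [quad_gram, Nat.zero_add]
    split_ifs <;> simp
  simp only [h3] at h1
  have hdep : DependsOn (fun p => (transition G p (k + s) k)ᵀ * transition G p (k + s) k)
      (Set.Iic (k + s)) := by
    have : ∀ u, DependsOn (fun p => transition G p (k + u) k) (Set.Iic (k + u)) := by
      intro u
      induction u with
      | zero => intro p p' _; simp [transition_self]
      | succ u ih =>
        intro p p' hp
        simp only [transition_succ]
        rw [hp (k + u) (Set.mem_Iic.2 (by omega))]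
        congr 1
        exact ih fun l hl => hp l (Set.mem_Iic.2 (by have := Set.mem_Iic.1 hl; omega))
    intro p p' hp
    have := this s hp
    simp only at this ⊢
    rw [this]
  rw [← quad_condExpect hM.1 (hpos i k) hdep x] at h1
  have h4 := quad_le_of_le (hstab i (k + s) k (Nat.le_add_right k s)) x
  rw [quad_smul, quad_one, Nat.add_sub_cancel_left] at h4
  rw [mul_left_cancel₀ (hpos i k).ne' h1]
  exact h4

end FreeMotion

/-! ### Lyapunov function and energy estimate -/

section Energy

variable {N n m q J : ℕ} (G : SystemMatrices N n m q) (Pi : Fin J → Matrix (Fin N) (Fin N) ℝ)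

/-- `∑_{s ≤ r} E[Φ(k+s,k)ᵀ Φ(k+s,k) | θ(k) = i]`, a Lyapunov function of the free system. -/
def lyapunovSum (ψ : SwitchingSequence J) (r : ℕ) (i : Fin N) (k : ℕ) :
    Matrix (Fin n) (Fin n) ℝ :=
  ∑ s ∈ Finset.range (r + 1), freeGram G Pi ψ s i k

theorem lyapunovSum_isSymm (ψ : SwitchingSequence J) (r : ℕ) (i : Fin N) (k : ℕ) :
    (lyapunovSum G Pi ψ r i k).IsSymm := by
  simp only [Matrix.IsSymm, lyapunovSum, transpose_sum, (freeGram_isSymm G Pi ψ _ i k).eq]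

/-- Shifting the summation index leaves the term `s = 0`, which is the identity; it supplies the
decrease along the free motion. -/
theorem quad_lyapunovSum_succ (ψ : SwitchingSequence J) (r : ℕ) (i : Fin N) (k : ℕ)
    (x : Fin n → ℝ) :
    quad (lyapunovSum G Pi ψ (r + 1) i k) x
      = quad (modeAverage (Pi (ψ k.succPNat)) (fun j => lyapunovSum G Pi ψ r j (k + 1)) i)
          (G.A i *ᵥ x) + x ⬝ᵥ x := by
  rw [lyapunovSum, Finset.sum_range_succ', quad_add, quad_modeAverage]
  simp only [quad_sum, lyapunovSum, freeGram, quad_conj, quad_one, quad_modeAverage,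
    Finset.mul_sum]
  rw [Finset.sum_comm]

variable {G Pi}

theorem lyapunovSum_nonneg (hPi : ∀ s, Pi s ∈ rowStochastic ℝ (Fin N))
    (ψ : SwitchingSequence J) (r : ℕ) (i : Fin N) (k : ℕ) (x : Fin n → ℝ) :
    0 ≤ quad (lyapunovSum G Pi ψ r i k) x := by
  rw [lyapunovSum, quad_sum]
  exact Finset.sum_nonneg fun s _ => freeGram_nonneg G Pi hPi ψ s i k x

variable {Ω : Type*} [MeasurableSpace Ω] {P : Measure Ω} [IsProbabilityMeasure P]

theorem exists_lyapunovSum_le {Ψ : Set (SwitchingSequence J)} {p₀ : Fin N → ℝ}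
    {θ : SwitchingSequence J → ℕ → Ω → Fin N}
    (hθ : ∀ ψ ∈ Ψ, IsMarkovChain P (θ ψ) p₀ (fun k => Pi (ψ k)))
    (hpos : ∀ ψ ∈ Ψ, ∀ (i : Fin N) (k : ℕ), 0 < P.real {ω | θ ψ k ω = i})
    (hstab : UniformlyExpMeanSquareStable G P Ψ θ) :
    ∃ h : ℝ, 1 ≤ h ∧ ∀ ψ ∈ Ψ, ∀ r i k x,
      quad (lyapunovSum G Pi ψ r i k) x ≤ h * (x ⬝ᵥ x) := by
  obtain ⟨c, lam, hc, h0, h1, hs⟩ := hstab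
  refine ⟨c * (1 - lam)⁻¹, ?_, fun ψ hψ r i k x => ?_⟩
  · have : 1 ≤ (1 - lam)⁻¹ := (one_le_inv₀ (by linarith)).2 (by linarith)
    nlinarith
  · rw [lyapunovSum, quad_sum]
    calc _ ≤ ∑ s ∈ Finset.range (r + 1), c * lam ^ s * (x ⬝ᵥ x) :=
          Finset.sum_le_sum fun s _ =>
            freeGram_le (hθ ψ hψ) (hpos ψ hψ) (hs ψ hψ) s i k x
      _ = c * (∑ s ∈ Finset.range (r + 1), lam ^ s) * (x ⬝ᵥ x) := by
          rw [← Finset.sum_mul, Finset.mul_sum]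
      _ ≤ _ := by
          refine mul_le_mul_of_nonneg_right (mul_le_mul_of_nonneg_left ?_ (by linarith))
            (dotProduct_self_nonneg' x)
          rw [← tsum_geometric_of_lt_one h0 h1]
          exact (summable_geometric_of_lt_one h0 h1).sum_le_tsum _ fun i _ => pow_nonneg h0 i

theorem lyapunovSum_dissipation (hPi : ∀ s, Pi s ∈ rowStochastic ℝ (Fin N)) {h b : ℝ}
    (h1 : 1 ≤ h) {ψ : SwitchingSequence J}
    (hle : ∀ r i k x, quad (lyapunovSum G Pi ψ r i k) x ≤ h * (x ⬝ᵥ x))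
    (hb : ∀ i v, (G.B i *ᵥ v) ⬝ᵥ (G.B i *ᵥ v) ≤ b * (v ⬝ᵥ v))
    (r : ℕ) (i : Fin N) (k : ℕ) (x : Fin n → ℝ) (v : Fin m → ℝ) :
    quad (modeAverage (Pi (ψ k.succPNat)) (fun j => lyapunovSum G Pi ψ r j (k + 1)) i)
        (G.A i *ᵥ x + G.B i *ᵥ v)
      ≤ quad (lyapunovSum G Pi ψ (r + 1) i k) x - x ⬝ᵥ x / 2
        + (1 + 2 * h) * h * b * (v ⬝ᵥ v) := by
  set H := modeAverage (Pi (ψ k.succPNat)) (fun j => lyapunovSum G Pi ψ r j (k + 1)) i with hH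
  have hsymm : H.IsSymm := modeAverage_isSymm (fun j => lyapunovSum_isSymm G Pi ψ r j (k + 1)) i
  have hnn : ∀ x, 0 ≤ quad H x := fun x =>
    quad_modeAverage_nonneg (hPi _) (fun j => lyapunovSum_nonneg hPi ψ r j (k + 1) x) i
  have hHle : ∀ x, quad H x ≤ h * (x ⬝ᵥ x) := fun x =>
    quad_modeAverage_le (hPi _) (fun j => hle r j (k + 1) x) i
  -- With this weight in Young's inequality the extra free term costs at most half of the decrease
  -- `x ⬝ᵥ x`.
  have hδ : 0 < (2 * h)⁻¹ := by positivity
  have hY := quad_add_right_le hsymm hnn hδ (G.A i *ᵥ x) (G.B i *ᵥ v)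
  rw [inv_inv] at hY
  have hsucc := quad_lyapunovSum_succ G Pi ψ r i k x
  rw [← hH] at hsucc
  have hA : quad H (G.A i *ᵥ x) ≤ h * (x ⬝ᵥ x) := by
    have := hle (r + 1) i k x
    linarith [dotProduct_self_nonneg' x]
  have hA' : (2 * h)⁻¹ * quad H (G.A i *ᵥ x) ≤ x ⬝ᵥ x / 2 := by
    calc _ ≤ (2 * h)⁻¹ * (h * (x ⬝ᵥ x)) := mul_le_mul_of_nonneg_left hA hδ.le
      _ = _ := by field_simp
  have hB : (1 + 2 * h) * quad H (G.B i *ᵥ v) ≤ (1 + 2 * h) * h * b * (v ⬝ᵥ v) := by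
    have h2 : quad H (G.B i *ᵥ v) ≤ h * (b * (v ⬝ᵥ v)) :=
      (hHle _).trans (mul_le_mul_of_nonneg_left (hb i v) (by linarith))
    calc _ ≤ (1 + 2 * h) * (h * (b * (v ⬝ᵥ v))) :=
          mul_le_mul_of_nonneg_left h2 (by linarith)
      _ = _ := by ring
  linarith

/-- Mean square stability implies a finite-horizon `ℓ²` bound of the state by the initial state
and the disturbance. -/
theorem exists_energy_bound (hPi : ∀ s, Pi s ∈ rowStochastic ℝ (Fin N))
    {Ψ : Set (SwitchingSequence J)} {p₀ : Fin N → ℝ}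
    {θ : SwitchingSequence J → ℕ → Ω → Fin N}
    (hθ : ∀ ψ ∈ Ψ, IsMarkovChain P (θ ψ) p₀ (fun k => Pi (ψ k)))
    (hpos : ∀ ψ ∈ Ψ, ∀ (i : Fin N) (k : ℕ), 0 < P.real {ω | θ ψ k ω = i})
    (hstab : UniformlyExpMeanSquareStable G P Ψ θ) :
    ∃ c : ℝ, 0 ≤ c ∧ ∀ ψ ∈ Ψ, ∀ k x w, IsDriven G k x w → ∀ R,
      ∑ s ∈ Finset.range R, ∫ ω, (x s fun l => θ ψ l ω) ⬝ᵥ (x s fun l => θ ψ l ω) ∂P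
        ≤ c * (∫ ω, (x 0 fun l => θ ψ l ω) ⬝ᵥ (x 0 fun l => θ ψ l ω) ∂P
          + ∑ s ∈ Finset.range R,
            ∫ ω, (w s fun l => θ ψ l ω) ⬝ᵥ (w s fun l => θ ψ l ω) ∂P) := by
  obtain ⟨h, h1, hle⟩ := exists_lyapunovSum_le hθ hpos hstab
  obtain ⟨b, hb0, hb⟩ := exists_mulVec_bound G.B
  refine ⟨2 * ((1 + 2 * h) * h * b + h), by positivity, fun ψ hψ k x w hd R => ?_⟩
  have hM := hθ ψ hψ
  set C := (1 + 2 * h) * h * b with hC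
  have hC0 : 0 ≤ C := by positivity
  set Ex : ℕ → ℝ := fun s => ∫ ω, (x s fun l => θ ψ l ω) ⬝ᵥ (x s fun l => θ ψ l ω) ∂P with hEx
  set Ew : ℕ → ℝ := fun s => ∫ ω, (w s fun l => θ ψ l ω) ⬝ᵥ (w s fun l => θ ψ l ω) ∂P with hEw
  -- The truncation shrinks with `s` because each step of the dissipation inequality uses one term
  -- of the sum.
  set V : ℕ → ℝ := fun s => ∫ ω, quad (lyapunovSum G Pi ψ (R - s) (θ ψ (k + s) ω) (k + s))
    (x s fun l => θ ψ l ω) ∂P with hV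
  have ix : ∀ s, Integrable (fun ω => (x s fun l => θ ψ l ω) ⬝ᵥ (x s fun l => θ ψ l ω)) P :=
    fun s => integrable_of_dependsOn hM.1 (dependsOn_normSq (hd.dependsOn s))
  have iw : ∀ s, Integrable (fun ω => (w s fun l => θ ψ l ω) ⬝ᵥ (w s fun l => θ ψ l ω)) P :=
    fun s => integrable_of_dependsOn hM.1 (dependsOn_normSq (hd.input s))
  have iV : ∀ s r, Integrable (fun ω => quad (lyapunovSum G Pi ψ r (θ ψ (k + s) ω) (k + s))
      (x s fun l => θ ψ l ω)) P := fun s r =>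
    integrable_of_dependsOn hM.1 (dependsOn_quad le_rfl (hd.dependsOn s)
      fun j => lyapunovSum G Pi ψ r j (k + s))
  have i1 : ∀ s r, Integrable (fun ω => quad (lyapunovSum G Pi ψ r (θ ψ (k + s) ω) (k + s))
      (x s fun l => θ ψ l ω) - (x s fun l => θ ψ l ω) ⬝ᵥ (x s fun l => θ ψ l ω) / 2) P :=
    fun s r => (iV s r).sub ((ix s).div_const 2)
  have hstep : ∀ s < R, V (s + 1) ≤ V s - Ex s / 2 + C * Ew s := by
    intro s hs
    have hr : R - s = R - (s + 1) + 1 := by omega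
    simp only [hV, hEx, hEw]
    rw [hd.integral_quad_succ hM (fun j => lyapunovSum G Pi ψ (R - (s + 1)) j (k + (s + 1))) s,
      ← integral_div, ← integral_const_mul, ← integral_sub (iV s _) ((ix s).div_const 2),
      ← integral_add (i1 s _) ((iw s).const_mul C), hr]
    refine integral_mono ?_ ((i1 s _).add ((iw s).const_mul C))
      fun ω => lyapunovSum_dissipation hPi h1 (hle ψ hψ) hb _ _ (k + s) _ _
    refine integrable_of_dependsOn hM.1 (t := k + s) (F := fun p =>
      quad (modeAverage (Pi (ψ (k + s).succPNat))
        (fun j => lyapunovSum G Pi ψ (R - (s + 1)) j (k + (s + 1))) (p (k + s)))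
        (G.A (p (k + s)) *ᵥ x s p + G.B (p (k + s)) *ᵥ w s p)) fun p p' hp => ?_
    simp only
    rw [hd.dependsOn s hp, hd.input s hp, hp (k + s) (Set.mem_Iic.2 le_rfl)]
  have hsum : ∀ s ≤ R, V s + (∑ u ∈ Finset.range s, Ex u) / 2
      ≤ V 0 + C * ∑ u ∈ Finset.range s, Ew u := by
    intro s hs
    induction s with
    | zero => simp
    | succ s ih =>
      rw [Finset.sum_range_succ, Finset.sum_range_succ]
      have := ih (by omega)
      have := hstep s (by omega)
      linarith
  have hVR : 0 ≤ V R := integral_nonneg fun ω => lyapunovSum_nonneg hPi ψ _ _ _ _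
  have hV0 : V 0 ≤ h * Ex 0 := by
    simp only [hV, hEx]
    rw [← integral_const_mul]
    exact integral_mono (iV 0 _) ((ix 0).const_mul h) fun ω => hle ψ hψ _ _ _ _
  have hEw0 : 0 ≤ ∑ u ∈ Finset.range R, Ew u :=
    Finset.sum_nonneg fun u _ => integral_nonneg fun ω => dotProduct_self_nonneg' _
  have hEx0 : 0 ≤ Ex 0 := integral_nonneg fun ω => dotProduct_self_nonneg' _
  have := hsum R le_rfl
  have h3 : 0 ≤ C * Ex 0 := mul_nonneg hC0 hEx0
  have h4 : 0 ≤ h * ∑ u ∈ Finset.range R, Ew u := mul_nonneg (by linarith) hEw0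
  change ∑ s ∈ Finset.range R, Ex s ≤ 2 * (C + h) * (Ex 0 + ∑ s ∈ Finset.range R, Ew s)
  linarith

end Energy

end SwitchedMJLS

end

noncomputable section

namespace SwitchedMJLS

open Matrix

/-! ### Contractivity from an arbitrary starting time -/

section Contraction

variable {N n m q J : ℕ} {G : SystemMatrices N n m q}
variable {Ω : Type*} [MeasurableSpace Ω] {P : Measure Ω} [IsProbabilityMeasure P]
  {θ : ℕ → Ω → Fin N}

theorem enorm_toLp_sq {d : ℕ} (x : Fin d → ℝ) :
    ‖WithLp.toLp 2 x‖ₑ ^ 2 = ENNReal.ofReal (x ⬝ᵥ x) := by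
  rw [← ofReal_norm, ← ENNReal.ofReal_pow (norm_nonneg _), EuclideanSpace.real_norm_sq_eq]
  simp [dotProduct, pow_two]

theorem lintegral_enorm_toLp_sq {d t : ℕ} (hθ : ∀ k, Measurable (θ k))
    {y : (ℕ → Fin N) → Fin d → ℝ} (hy : DependsOn y (Set.Iic t)) :
    ∫⁻ ω, ‖WithLp.toLp 2 (y fun l => θ l ω)‖ₑ ^ 2 ∂P
      = ENNReal.ofReal (∫ ω, (y fun l => θ l ω) ⬝ᵥ (y fun l => θ l ω) ∂P) := by
  simp only [enorm_toLp_sq]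
  exact (ofReal_integral_eq_lintegral_ofReal (integrable_of_dependsOn hθ (dependsOn_normSq hy))
    (Filter.Eventually.of_forall fun ω => dotProduct_self_nonneg' _)).symm

omit [IsProbabilityMeasure P] in
theorem l2eNorm_sq {d : ℕ} (w : ℕ → Ω → EuclideanSpace ℝ (Fin d)) :
    l2eNorm P w ^ 2 = ∑' k, ∫⁻ ω, ‖w k ω‖ₑ ^ 2 ∂P := by
  rw [l2eNorm, ← ENNReal.rpow_natCast, ← ENNReal.rpow_mul]
  norm_num

/-- The disturbance which is zero before time `k` and then `w 0, w 1, …`. -/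
def delayedInput (k : ℕ) (w : ℕ → (ℕ → Fin N) → Fin m → ℝ) (t : ℕ) (p : ℕ → Fin N) :
    EuclideanSpace ℝ (Fin m) :=
  if t < k then 0 else WithLp.toLp 2 (w (t - k) p)

theorem state_delayedInput_of_le {k : ℕ} {w : ℕ → (ℕ → Fin N) → Fin m → ℝ} (p : ℕ → Fin N)
    {t : ℕ} (ht : t ≤ k) : state G p 0 (fun l => delayedInput k w l p) t = 0 := by
  induction t with
  | zero => rfl
  | succ t ih =>
    rw [state, ih (by omega)]
    simp [delayedInput, show t < k by omega]

theorem state_delayedInput {k : ℕ} {x : ℕ → (ℕ → Fin N) → Fin n → ℝ}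
    {w : ℕ → (ℕ → Fin N) → Fin m → ℝ} (h : IsDriven G k x w) (h0 : x 0 = 0) (p : ℕ → Fin N)
    (s : ℕ) : state G p 0 (fun l => delayedInput k w l p) (k + s) = WithLp.toLp 2 (x s p) := by
  induction s with
  | zero => rw [Nat.add_zero, state_delayedInput_of_le p le_rfl, h0]; rfl
  | succ s ih =>
    rw [← Nat.add_assoc, state, ih, h.step]
    simp [delayedInput, toLpLin_toLp]

/-- The hypothesis concerns starts at time zero. A disturbance delayed by `k` keeps the state at
zero until time `k`, and one that vanishes from step `R` on has finite energy; output energy outside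
the window is discarded. -/
theorem UniformlyMeanSquareStrictlyContractive.exists_driven_bound
    {Ψ : Set (SwitchingSequence J)} {θ : SwitchingSequence J → ℕ → Ω → Fin N}
    (hθ : ∀ ψ ∈ Ψ, ∀ k, Measurable (θ ψ k))
    (hcontr : UniformlyMeanSquareStrictlyContractive G P Ψ θ) :
    ∃ γ : ℝ, 0 < γ ∧ γ < 1 ∧ ∀ ψ ∈ Ψ, ∀ k x w, IsDriven G k x w → x 0 = 0 → ∀ R,
      (∀ s, R ≤ s → w s = 0) →
      ∑ s ∈ Finset.range R, ∫ ω,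
          (G.C (θ ψ (k + s) ω) *ᵥ x s (fun l => θ ψ l ω)
            + G.D (θ ψ (k + s) ω) *ᵥ w s (fun l => θ ψ l ω))
          ⬝ᵥ (G.C (θ ψ (k + s) ω) *ᵥ x s (fun l => θ ψ l ω)
            + G.D (θ ψ (k + s) ω) *ᵥ w s (fun l => θ ψ l ω)) ∂P
        ≤ γ ^ 2 * ∑ s ∈ Finset.range R,
            ∫ ω, (w s fun l => θ ψ l ω) ⬝ᵥ (w s fun l => θ ψ l ω) ∂P := by
  obtain ⟨γ, h0, h1, hc⟩ := hcontr
  refine ⟨γ, h0, h1, fun ψ hψ k x w hd hx0 R hR => ?_⟩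
  have hm := hθ ψ hψ
  set W : ℕ → Ω → EuclideanSpace ℝ (Fin m) :=
    fun t ω => delayedInput k w t fun l => θ ψ l ω with hW
  have hWzero : ∀ t ∉ Finset.range (k + R), ∫⁻ ω, ‖W t ω‖ₑ ^ 2 ∂P = 0 := by
    intro t ht
    rw [Finset.mem_range, not_lt] at ht
    simp [hW, delayedInput, show ¬ t < k by omega, hR (t - k) (by omega)]
  have hWsum : l2eNorm P W ^ 2 = ENNReal.ofReal (∑ s ∈ Finset.range R,
      ∫ ω, (w s fun l => θ ψ l ω) ⬝ᵥ (w s fun l => θ ψ l ω) ∂P) := by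
    rw [l2eNorm_sq, tsum_eq_sum hWzero, Finset.sum_range_add,
      Finset.sum_eq_zero, zero_add, ENNReal.ofReal_sum_of_nonneg]
    · refine Finset.sum_congr rfl fun s _ => ?_
      rw [← lintegral_enorm_toLp_sq hm (hd.input s)]
      simp [hW, delayedInput]
    · exact fun s _ => integral_nonneg fun ω => dotProduct_self_nonneg' _
    · intro t ht
      simp [hW, delayedInput, Finset.mem_range.1 ht]
  have hmem : MemL2e P W := by
    constructor
    · intro t
      by_cases ht : t < k
      · simp only [hW, delayedInput, ht, if_true]; exact measurable_const
      · simp only [hW, delayedInput, ht, if_false]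
        exact measurable_of_dependsOn hm (F := fun p => WithLp.toLp 2 (w (t - k) p))
          (t := k + (t - k)) fun p p' hp => by simp only; rw [hd.input (t - k) hp]
    · by_contra hne
      rw [not_lt, top_le_iff] at hne
      rw [hne] at hWsum
      exact ENNReal.ofReal_ne_top (hWsum.symm.trans (by simp))
  have hmain := pow_le_pow_left' (hc ψ hψ W hmem) 2
  rw [mul_pow, hWsum, l2eNorm_sq, ← ENNReal.ofReal_pow h0.le,
    ← ENNReal.ofReal_mul (by positivity)] at hmain
  have hz : ∀ s, DependsOn (fun p => G.C (p (k + s)) *ᵥ x s p + G.D (p (k + s)) *ᵥ w s p)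
      (Set.Iic (k + s)) := fun s p p' hp => by
    simp only
    rw [hd.dependsOn s hp, hd.input s hp, hp (k + s) (Set.mem_Iic.2 le_rfl)]
  rw [← ENNReal.ofReal_le_ofReal_iff (mul_nonneg (by positivity) (Finset.sum_nonneg fun s _ =>
    integral_nonneg fun ω => dotProduct_self_nonneg' _)), ENNReal.ofReal_sum_of_nonneg
    fun s _ => integral_nonneg fun ω => dotProduct_self_nonneg' _]
  refine le_trans ?_ hmain
  refine le_trans ?_ (ENNReal.sum_le_tsum (Finset.range (k + R)))
  rw [Finset.sum_range_add]
  refine le_trans (le_of_eq ?_) le_add_self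
  refine Finset.sum_congr rfl fun s _ => ?_
  rw [← lintegral_enorm_toLp_sq hm (hz s)]
  refine lintegral_congr fun ω => ?_
  simp only [output, hW]
  rw [state_delayedInput hd hx0]
  simp [delayedInput, toLpLin_toLp]

end Contraction

/-! ### Closed-loop cost and uniform stage-cost bound -/

section ClosedLoop

variable {N n m q J : ℕ} (G : SystemMatrices N n m q)

/-- The state of the loop closed at the steps `s ≥ 1` by the gains `K s`, started at time `k`
with the state `x₀` and the disturbance `v` on the event that the mode is `i`, and with zero
otherwise. -/
def loopState (k : ℕ) (i : Fin N) (x₀ : Fin n → ℝ) (v : Fin m → ℝ)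
    (K : ℕ → Fin N → Matrix (Fin m) (Fin n) ℝ) : ℕ → (ℕ → Fin N) → Fin n → ℝ
  | 0, p => if p k = i then x₀ else 0
  | s + 1, p => G.A (p (k + s)) *ᵥ loopState k i x₀ v K s p
      + G.B (p (k + s)) *ᵥ (if s = 0 then (if p k = i then v else 0) else
          K s (p (k + s)) *ᵥ loopState k i x₀ v K s p)

/-- The disturbance which belongs to `loopState`. -/
def loopInput (k : ℕ) (i : Fin N) (x₀ : Fin n → ℝ) (v : Fin m → ℝ)
    (K : ℕ → Fin N → Matrix (Fin m) (Fin n) ℝ) (s : ℕ) (p : ℕ → Fin N) : Fin m → ℝ :=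
  if s = 0 then (if p k = i then v else 0) else
    K s (p (k + s)) *ᵥ loopState G k i x₀ v K s p

theorem isDriven_loop (k : ℕ) (i : Fin N) (x₀ : Fin n → ℝ) (v : Fin m → ℝ)
    (K : ℕ → Fin N → Matrix (Fin m) (Fin n) ℝ) :
    IsDriven G k (loopState G k i x₀ v K) (loopInput G k i x₀ v K) := by
  have hx : ∀ s, DependsOn (loopState G k i x₀ v K s) (Set.Iic (k + s)) := by
    intro s
    induction s with
    | zero => intro p p' hp; simp only [loopState, hp k (Set.mem_Iic.2 (by omega))]
    | succ s ih =>
      intro p p' hp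
      have h1 := ih (x := p) (y := p') fun l hl => hp l (Set.mem_Iic.2 (by
        have := Set.mem_Iic.1 hl; omega))
      simp only [loopState, h1, hp k (Set.mem_Iic.2 (by omega)),
        hp (k + s) (Set.mem_Iic.2 (by omega))]
  refine ⟨hx 0, fun s p p' hp => ?_, fun s p => rfl⟩
  simp only [loopInput, hx s hp, hp k (Set.mem_Iic.2 (by omega)),
    hp (k + s) (Set.mem_Iic.2 le_rfl)]

/-- The response to the disturbance `w` from the zero state at time `k`. -/
def forcedState (k : ℕ) (w : ℕ → (ℕ → Fin N) → Fin m → ℝ) : ℕ → (ℕ → Fin N) → Fin n → ℝ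
  | 0, _ => 0
  | s + 1, p => G.A (p (k + s)) *ᵥ forcedState k w s p + G.B (p (k + s)) *ᵥ w s p

variable {G}

theorem IsDriven.forced {k : ℕ} {x : ℕ → (ℕ → Fin N) → Fin n → ℝ}
    {w : ℕ → (ℕ → Fin N) → Fin m → ℝ} (h : IsDriven G k x w) :
    IsDriven G k (forcedState G k w) w :=
  ⟨fun _ _ _ => rfl, h.input, fun _ _ => rfl⟩

/-- By linearity, subtracting the forced response leaves a free motion with the same initial state.
-/
theorem IsDriven.free {k : ℕ} {x : ℕ → (ℕ → Fin N) → Fin n → ℝ}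
    {w : ℕ → (ℕ → Fin N) → Fin m → ℝ} (h : IsDriven G k x w) :
    IsDriven G k (fun s p => x s p - forcedState G k w s p) 0 where
  init p p' hp := by simp only [h.init hp, forcedState]
  input _ _ _ _ := rfl
  step s p := by
    simp only [h.step, forcedState, mulVec_sub, _root_.Pi.zero_apply, mulVec_zero]
    abel

variable {Ω : Type*} [MeasurableSpace Ω] {P : Measure Ω} [IsProbabilityMeasure P]
  {Pi : Fin J → Matrix (Fin N) (Fin N) ℝ}

/-- The value of the closed loop is the stage cost of its first step. -/
theorem integral_stageCost_loop {θ : ℕ → Ω → Fin N} {p₀ : Fin N → ℝ} {ψ : SwitchingSequence J}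
    (hM : IsMarkovChain P θ p₀ fun k => Pi (ψ k)) {k r : ℕ} {ε : ℝ} (i : Fin N)
    (x₀ : Fin n → ℝ) (v : Fin m → ℝ) {K : ℕ → Fin N → Matrix (Fin m) (Fin n) ℝ}
    {Q : ℕ → Fin N → Matrix (Fin n) (Fin n) ℝ} (hQ0 : Q (r + 1) = 0)
    (hQ : ∀ s, 1 ≤ s → s ≤ r → ∀ j x,
      stageCost G j (modeAverage (Pi (ψ (k + s).succPNat)) (Q (s + 1)) j) x (K s j *ᵥ x)
        + ε * (x ⬝ᵥ x) = quad (Q s j) x)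
    {x : ℕ → (ℕ → Fin N) → Fin n → ℝ} (hx : x = loopState G k i x₀ v K)
    {w : ℕ → (ℕ → Fin N) → Fin m → ℝ} (hw : w = loopInput G k i x₀ v K) :
    P.real {ω | θ k ω = i} * (stageCost G i (modeAverage (Pi (ψ k.succPNat)) (Q 1) i) x₀ v
        + ε * (x₀ ⬝ᵥ x₀))
      = ∑ s ∈ Finset.range (r + 1),
        (∫ ω, (G.C (θ (k + s) ω) *ᵥ x s (fun l => θ l ω)
            + G.D (θ (k + s) ω) *ᵥ w s (fun l => θ l ω))
          ⬝ᵥ (G.C (θ (k + s) ω) *ᵥ x s (fun l => θ l ω)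
            + G.D (θ (k + s) ω) *ᵥ w s (fun l => θ l ω)) ∂P
          + ε * ∫ ω, (x s fun l => θ l ω) ⬝ᵥ (x s fun l => θ l ω) ∂P
          - ∫ ω, (w s fun l => θ l ω) ⬝ᵥ (w s fun l => θ l ω) ∂P) := by
  have hd : IsDriven G k x w := by rw [hx, hw]; exact isDriven_loop G k i x₀ v K
  set c : ℕ → ℝ := fun s => ∫ ω, (G.C (θ (k + s) ω) *ᵥ x s (fun l => θ l ω)
            + G.D (θ (k + s) ω) *ᵥ w s (fun l => θ l ω))
          ⬝ᵥ (G.C (θ (k + s) ω) *ᵥ x s (fun l => θ l ω)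
            + G.D (θ (k + s) ω) *ᵥ w s (fun l => θ l ω)) ∂P
          + ε * ∫ ω, (x s fun l => θ l ω) ⬝ᵥ (x s fun l => θ l ω) ∂P
          - ∫ ω, (w s fun l => θ l ω) ⬝ᵥ (w s fun l => θ l ω) ∂P with hc
  set V : ℕ → ℝ := fun s => ∫ ω, quad (Q s (θ (k + s) ω)) (x s fun l => θ l ω) ∂P with hV
  set U : ℕ → ℝ := fun s => ∫ ω, (stageCost G (θ (k + s) ω)
      (modeAverage (Pi (ψ (k + s).succPNat)) (Q (s + 1)) (θ (k + s) ω)) (x s fun l => θ l ω)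
      (w s fun l => θ l ω) + ε * ((x s fun l => θ l ω) ⬝ᵥ (x s fun l => θ l ω))) ∂P with hU
  have hUV : ∀ s, U s = V (s + 1) + c s := by
    intro s
    simp only [hU, hV, hc]
    rw [hd.integral_quad_succ hM (Q (s + 1)) s]
    have hxd : ∀ {p p' : ℕ → Fin N}, (∀ l ∈ Set.Iic (k + s), p l = p' l) → x s p = x s p' :=
      fun hp => hd.dependsOn s hp
    have hwd : ∀ {p p' : ℕ → Fin N}, (∀ l ∈ Set.Iic (k + s), p l = p' l) → w s p = w s p' :=
      fun hp => hd.input s hp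
    have ix : Integrable (fun ω => ε * ((x s fun l => θ l ω) ⬝ᵥ (x s fun l => θ l ω))) P :=
      (integrable_of_dependsOn hM.1 (dependsOn_normSq (hd.dependsOn s))).const_mul ε
    have iw : Integrable (fun ω => (w s fun l => θ l ω) ⬝ᵥ (w s fun l => θ l ω)) P :=
      integrable_of_dependsOn hM.1 (dependsOn_normSq (hd.input s))
    have iz : Integrable (fun ω => (G.C (θ (k + s) ω) *ᵥ x s (fun l => θ l ω)
            + G.D (θ (k + s) ω) *ᵥ w s (fun l => θ l ω))
          ⬝ᵥ (G.C (θ (k + s) ω) *ᵥ x s (fun l => θ l ω)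
            + G.D (θ (k + s) ω) *ᵥ w s (fun l => θ l ω))) P :=
      integrable_of_dependsOn hM.1 (dependsOn_normSq (t := k + s)
        (y := fun p => G.C (p (k + s)) *ᵥ x s p + G.D (p (k + s)) *ᵥ w s p) fun p p' hp => by
        simp only
        rw [hxd hp, hwd hp, hp (k + s) (Set.mem_Iic.2 le_rfl)])
    have iq : Integrable (fun ω => quad (modeAverage (Pi (ψ (k + s).succPNat)) (Q (s + 1))
          (θ (k + s) ω)) (G.A (θ (k + s) ω) *ᵥ x s (fun l => θ l ω)
            + G.B (θ (k + s) ω) *ᵥ w s (fun l => θ l ω))) P :=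
      integrable_of_dependsOn hM.1 (t := k + s) (F := fun p =>
        quad (modeAverage (Pi (ψ (k + s).succPNat)) (Q (s + 1)) (p (k + s)))
          (G.A (p (k + s)) *ᵥ x s p + G.B (p (k + s)) *ᵥ w s p)) fun p p' hp => by
        simp only
        rw [hxd hp, hwd hp, hp (k + s) (Set.mem_Iic.2 le_rfl)]
    have izx : Integrable (fun ω => (G.C (θ (k + s) ω) *ᵥ x s (fun l => θ l ω)
            + G.D (θ (k + s) ω) *ᵥ w s (fun l => θ l ω))
          ⬝ᵥ (G.C (θ (k + s) ω) *ᵥ x s (fun l => θ l ω)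
            + G.D (θ (k + s) ω) *ᵥ w s (fun l => θ l ω))
          + ε * ((x s fun l => θ l ω) ⬝ᵥ (x s fun l => θ l ω))) P := iz.add ix
    have izxw : Integrable (fun ω => (G.C (θ (k + s) ω) *ᵥ x s (fun l => θ l ω)
            + G.D (θ (k + s) ω) *ᵥ w s (fun l => θ l ω))
          ⬝ᵥ (G.C (θ (k + s) ω) *ᵥ x s (fun l => θ l ω)
            + G.D (θ (k + s) ω) *ᵥ w s (fun l => θ l ω))
          + ε * ((x s fun l => θ l ω) ⬝ᵥ (x s fun l => θ l ω))
          - (w s fun l => θ l ω) ⬝ᵥ (w s fun l => θ l ω)) P := izx.sub iw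
    rw [← integral_const_mul, ← integral_add iz ix, ← integral_sub izx iw, ← integral_add iq izxw]
    refine integral_congr_ae (Filter.Eventually.of_forall fun ω => ?_)
    simp only [stageCost]
    ring
  -- From step `1` on the input is the feedback for which `Q` solves the recursion, so the values
  -- telescope. At `s = 0` the input is the free choice `v`.
  have hUV' : ∀ s, 1 ≤ s → s ≤ r → U s = V s := by
    intro s h1 h2
    simp only [hU, hV]
    refine integral_congr_ae (Filter.Eventually.of_forall fun ω => ?_)
    simp only
    rw [← hQ s h1 h2, hw, loopInput, if_neg (by omega), hx]
  have hsum : ∀ s ≤ r, U 0 = V (s + 1) + ∑ u ∈ Finset.range (s + 1), c u := by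
    intro s hs
    induction s with
    | zero => simpa using hUV 0
    | succ s ih =>
      rw [Finset.sum_range_succ, ih (by omega), ← hUV' (s + 1) (by omega) hs, hUV (s + 1)]
      ring
  have hVr : V (r + 1) = 0 := by simp [hV, hQ0]
  have hU0 : U 0 = P.real {ω | θ k ω = i}
      * (stageCost G i (modeAverage (Pi (ψ k.succPNat)) (Q 1) i) x₀ v + ε * (x₀ ⬝ᵥ x₀)) := by
    rw [← integral_indicator_mode hM.1]
    simp only [hU, Nat.add_zero, Nat.zero_add]
    refine integral_congr_ae (Filter.Eventually.of_forall fun ω => ?_)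
    simp only [hx, hw, loopInput, loopState, if_true]
    split_ifs with h
    · rw [h]
    · simp [stageCost]
  rw [← hU0, hsum r le_rfl, hVr, zero_add]

/-- `Q` and `K` are arbitrary solutions of the gain recursion, so the estimate can be used before
the next Riccati step is known to be well posed. The constants do not depend on the number of steps
`r`. -/
theorem exists_stageCost_bound (hPi : ∀ s, Pi s ∈ rowStochastic ℝ (Fin N))
    {Ψ : Set (SwitchingSequence J)} {p₀ : Fin N → ℝ}
    {θ : SwitchingSequence J → ℕ → Ω → Fin N}
    (hθ : ∀ ψ ∈ Ψ, IsMarkovChain P (θ ψ) p₀ (fun k => Pi (ψ k)))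
    (hpos : ∀ ψ ∈ Ψ, ∀ (i : Fin N) (k : ℕ), 0 < P.real {ω | θ ψ k ω = i})
    (hstab : UniformlyExpMeanSquareStable G P Ψ θ)
    (hcontr : UniformlyMeanSquareStrictlyContractive G P Ψ θ) :
    ∃ η ρ κ : ℝ, 0 < η ∧ 0 < ρ ∧ 0 < κ ∧ ∀ ψ ∈ Ψ, ∀ ε, 0 ≤ ε → ε ≤ η → ∀ k r i
      (Q : ℕ → Fin N → Matrix (Fin n) (Fin n) ℝ) (K : ℕ → Fin N → Matrix (Fin m) (Fin n) ℝ),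
      Q (r + 1) = 0 → (∀ s, r < s → K s = 0) →
      (∀ s, 1 ≤ s → s ≤ r → ∀ j x,
        stageCost G j (modeAverage (Pi (ψ (k + s).succPNat)) (Q (s + 1)) j) x (K s j *ᵥ x)
          + ε * (x ⬝ᵥ x) = quad (Q s j) x) →
      ∀ x v, stageCost G i (modeAverage (Pi (ψ k.succPNat)) (Q 1) i) x v + ε * (x ⬝ᵥ x)
        ≤ ρ * (x ⬝ᵥ x) - κ * (v ⬝ᵥ v) := by
  obtain ⟨ce, hce0, hce⟩ := exists_energy_bound hPi hθ hpos hstab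
  obtain ⟨γ, hγ0, hγ1, hγ⟩ := hcontr.exists_driven_bound fun ψ hψ => (hθ ψ hψ).1
  obtain ⟨b, hb0, hb⟩ := exists_mulVec_bound G.C
  have hγ2 : γ ^ 2 < 1 := by nlinarith
  -- Makes `(1 + δ) * γ ^ 2` the midpoint of `γ ^ 2` and `1`; half of the contractivity slack is
  -- spent on the cross term.
  set δ : ℝ := (1 - γ ^ 2) / (2 * γ ^ 2) with hδ
  have hδ0 : 0 < δ := div_pos (by linarith) (by positivity)
  have hδγ : (1 + δ) * γ ^ 2 = (1 + γ ^ 2) / 2 := by rw [hδ]; field_simp; ring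
  -- A further quarter of the slack pays for the perturbation `ε`; the last quarter becomes `κ`.
  set η : ℝ := (1 - γ ^ 2) / (4 * (ce + 1)) with hη
  have hη0 : 0 < η := div_pos (by linarith) (by positivity)
  have hηce : η * ce ≤ (1 - γ ^ 2) / 4 := by
    rw [hη, div_mul_eq_mul_div, div_le_div_iff₀ (by positivity) (by norm_num)]
    nlinarith
  refine ⟨η, (1 + δ⁻¹) * (b * ce) + η * ce + 1, (1 - γ ^ 2) / 4, hη0, by positivity,
    by linarith, fun ψ hψ ε hε0 hε k r i Q K hQ0 hK hQ x₀ v => ?_⟩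
  have hM := hθ ψ hψ
  set p := P.real {ω | θ ψ k ω = i} with hp
  have hp0 : 0 < p := hpos ψ hψ i k
  set x := loopState G k i x₀ v K with hx
  set w := loopInput G k i x₀ v K with hw
  have hd : IsDriven G k x w := isDriven_loop G k i x₀ v K
  have hval := integral_stageCost_loop hM i x₀ v hQ0 hQ hx hw
  set Ez : ℕ → ℝ := fun s => ∫ ω, (G.C (θ ψ (k + s) ω) *ᵥ x s (fun l => θ ψ l ω)
            + G.D (θ ψ (k + s) ω) *ᵥ w s (fun l => θ ψ l ω))
          ⬝ᵥ (G.C (θ ψ (k + s) ω) *ᵥ x s (fun l => θ ψ l ω)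
            + G.D (θ ψ (k + s) ω) *ᵥ w s (fun l => θ ψ l ω)) ∂P with hEz
  set Ex : ℕ → ℝ := fun s => ∫ ω, (x s fun l => θ ψ l ω) ⬝ᵥ (x s fun l => θ ψ l ω) ∂P with hEx
  set Ew : ℕ → ℝ := fun s => ∫ ω, (w s fun l => θ ψ l ω) ⬝ᵥ (w s fun l => θ ψ l ω) ∂P with hEw
  have hEx0 : Ex 0 = p * (x₀ ⬝ᵥ x₀) := by
    rw [hp, ← integral_indicator_mode hM.1]
    refine integral_congr_ae (Filter.Eventually.of_forall fun ω => ?_)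
    simp only [hx, loopState]
    split_ifs <;> simp
  have hEw0 : Ew 0 = p * (v ⬝ᵥ v) := by
    rw [hp, ← integral_indicator_mode hM.1]
    refine integral_congr_ae (Filter.Eventually.of_forall fun ω => ?_)
    simp only [hw, loopInput, if_true]
    split_ifs <;> simp
  have hEwle : Ew 0 ≤ ∑ s ∈ Finset.range (r + 1), Ew s :=
    Finset.single_le_sum (f := Ew)
      (fun s _ => integral_nonneg fun ω => dotProduct_self_nonneg' _) (by simp)
  have hxsum := hce ψ hψ k x w hd (r + 1)
  have hwsum := hγ ψ hψ k _ w hd.forced rfl (r + 1) (fun s hs => by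
    funext p; simp [hw, loopInput, show s ≠ 0 by omega, hK s (by omega)])
  set f : ℕ → (ℕ → Fin N) → Fin n → ℝ := fun s p => x s p - forcedState G k w s p with hf
  have hfd : IsDriven G k f 0 := hd.free
  have hfsum := hce ψ hψ k f 0 hfd (r + 1)
  have hf0 : f 0 = x 0 := by funext p; simp [hf, forcedState]
  have hzle : ∀ s, Ez s ≤ (1 + δ) * ∫ ω,
          (G.C (θ ψ (k + s) ω) *ᵥ forcedState G k w s (fun l => θ ψ l ω)
            + G.D (θ ψ (k + s) ω) *ᵥ w s (fun l => θ ψ l ω))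
          ⬝ᵥ (G.C (θ ψ (k + s) ω) *ᵥ forcedState G k w s (fun l => θ ψ l ω)
            + G.D (θ ψ (k + s) ω) *ᵥ w s (fun l => θ ψ l ω)) ∂P
        + (1 + δ⁻¹) * b * ∫ ω, (f s fun l => θ ψ l ω) ⬝ᵥ (f s fun l => θ ψ l ω) ∂P := by
    intro s
    have iz : ∀ y, IsDriven G k y w → Integrable (fun ω =>
          (G.C (θ ψ (k + s) ω) *ᵥ y s (fun l => θ ψ l ω)
            + G.D (θ ψ (k + s) ω) *ᵥ w s (fun l => θ ψ l ω))
          ⬝ᵥ (G.C (θ ψ (k + s) ω) *ᵥ y s (fun l => θ ψ l ω)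
            + G.D (θ ψ (k + s) ω) *ᵥ w s (fun l => θ ψ l ω))) P := fun y hy =>
      integrable_of_dependsOn hM.1 (dependsOn_normSq (t := k + s)
        (y := fun p => G.C (p (k + s)) *ᵥ y s p + G.D (p (k + s)) *ᵥ w s p) fun p p' hp => by
        simp only
        rw [hy.dependsOn s hp, hy.input s hp, hp (k + s) (Set.mem_Iic.2 le_rfl)])
    have i2 : Integrable (fun ω => (f s fun l => θ ψ l ω) ⬝ᵥ (f s fun l => θ ψ l ω)) P :=
      integrable_of_dependsOn hM.1 (dependsOn_normSq (hfd.dependsOn s))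
    rw [← integral_const_mul, ← integral_const_mul,
      ← integral_add ((iz _ hd.forced).const_mul _) (i2.const_mul _)]
    refine integral_mono (iz _ hd) (((iz _ hd.forced).const_mul _).add (i2.const_mul _))
      fun ω => ?_
    set ω' : ℕ → Fin N := fun l => θ ψ l ω
    have h1 : G.C (θ ψ (k + s) ω) *ᵥ x s ω' + G.D (θ ψ (k + s) ω) *ᵥ w s ω'
        = (G.C (θ ψ (k + s) ω) *ᵥ forcedState G k w s ω' + G.D (θ ψ (k + s) ω) *ᵥ w s ω')
          + G.C (θ ψ (k + s) ω) *ᵥ f s ω' := by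
      simp only [hf, mulVec_sub]; abel
    have h2 := dotProduct_self_add_le hδ0
      (G.C (θ ψ (k + s) ω) *ᵥ forcedState G k w s ω' + G.D (θ ψ (k + s) ω) *ᵥ w s ω')
      (G.C (θ ψ (k + s) ω) *ᵥ f s ω')
    rw [← h1] at h2
    have h3 := mul_le_mul_of_nonneg_left (hb (θ ψ (k + s) ω) (f s ω'))
      (show 0 ≤ 1 + δ⁻¹ by positivity)
    simp only
    linarith
  have hzsum := Finset.sum_le_sum fun s (_ : s ∈ Finset.range (r + 1)) => hzle s
  rw [Finset.sum_add_distrib, ← Finset.mul_sum, ← Finset.mul_sum] at hzsum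
  simp only [_root_.Pi.zero_apply, dotProduct_zero, integral_zero, Finset.sum_const_zero, add_zero,
    hf0] at hfsum
  change _ ≤ ce * Ex 0 at hfsum
  change _ ≤ ce * (Ex 0 + ∑ s ∈ Finset.range (r + 1), Ew s) at hxsum
  change ∑ s ∈ Finset.range (r + 1), Ex s ≤ _ at hxsum
  change _ ≤ γ ^ 2 * ∑ s ∈ Finset.range (r + 1), Ew s at hwsum
  change _ = ∑ s ∈ Finset.range (r + 1), (Ez s + ε * Ex s - Ew s) at hval
  rw [Finset.sum_sub_distrib, Finset.sum_add_distrib, ← Finset.mul_sum] at hval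
  set Sz := ∑ s ∈ Finset.range (r + 1), Ez s
  set Sx := ∑ s ∈ Finset.range (r + 1), Ex s
  set Sw := ∑ s ∈ Finset.range (r + 1), Ew s
  have hEx0nn : 0 ≤ Ex 0 := by rw [hEx0]; exact mul_nonneg hp0.le (dotProduct_self_nonneg' _)
  have hSw : 0 ≤ Sw :=
    (integral_nonneg fun ω => dotProduct_self_nonneg' _ : 0 ≤ Ew 0).trans hEwle
  have e1 : ε * Sx ≤ η * ce * Ex 0 + (1 - γ ^ 2) / 4 * Sw := by
    calc ε * Sx ≤ ε * (ce * (Ex 0 + Sw)) := mul_le_mul_of_nonneg_left hxsum hε0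
      _ ≤ η * (ce * (Ex 0 + Sw)) := mul_le_mul_of_nonneg_right hε (by positivity)
      _ = η * ce * Ex 0 + η * ce * Sw := by ring
      _ ≤ _ := by gcongr
  have e2 : Sz ≤ (1 + γ ^ 2) / 2 * Sw + (1 + δ⁻¹) * (b * ce) * Ex 0 := by
    refine hzsum.trans (add_le_add ?_ ?_)
    · rw [← hδγ, mul_assoc]
      exact mul_le_mul_of_nonneg_left hwsum (by positivity)
    · calc _ ≤ (1 + δ⁻¹) * b * (ce * Ex 0) := mul_le_mul_of_nonneg_left hfsum (by positivity)
        _ = _ := by ring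
  have e3 : (1 - γ ^ 2) / 4 * Ew 0 ≤ (1 - γ ^ 2) / 4 * Sw :=
    mul_le_mul_of_nonneg_left hEwle (by linarith)
  refine le_of_mul_le_mul_left ?_ hp0
  rw [hval]
  calc Sz + ε * Sx - Sw ≤ ((1 + δ⁻¹) * (b * ce) + η * ce + 1) * Ex 0
        - (1 - γ ^ 2) / 4 * Ew 0 := by linarith
    _ = _ := by rw [hEx0, hEw0]; ring

end ClosedLoop

end SwitchedMJLS

end

noncomputable section

namespace SwitchedMJLS

open Matrix

/-! ### Well-posedness and uniform bounds of the Riccati recursion -/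

section Riccati

variable {N n m q J : ℕ} (G : SystemMatrices N n m q) (Pi : Fin J → Matrix (Fin N) (Fin N) ℝ)

/-- The average of the Riccati solution with `r` steps to go after time `k + 1`. -/
def riccatiAverage (ψ : SwitchingSequence J) (ε : ℝ) (r : ℕ) (i : Fin N) (k : ℕ) :
    Matrix (Fin n) (Fin n) ℝ :=
  modeAverage (Pi (ψ k.succPNat)) (fun j => riccatiSteps G Pi ψ ε r j (k + 1)) i

theorem riccatiSteps_succ (ψ : SwitchingSequence J) (ε : ℝ) (r : ℕ) (i : Fin N) (k : ℕ) :
    riccatiSteps G Pi ψ ε (r + 1) i k = opS G i (riccatiAverage G Pi ψ ε r i k) + ε • 1 := rfl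

/-- The Riccati solution with `r` steps to go is symmetric and positive semidefinite, and one
more backward step is uniformly well posed. -/
structure RiccatiBound (ψ : SwitchingSequence J) (ε ρ κ : ℝ) (r : ℕ) : Prop where
  symm : ∀ i k, (riccatiSteps G Pi ψ ε r i k).IsSymm
  nonneg : ∀ i k x, 0 ≤ quad (riccatiSteps G Pi ψ ε r i k) x
  stage : ∀ i k x v, stageCost G i (riccatiAverage G Pi ψ ε r i k) x v + ε * (x ⬝ᵥ x)
    ≤ ρ * (x ⬝ᵥ x) - κ * (v ⬝ᵥ v)

/-- The worst-case feedback gain with `r` steps to go. -/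
def riccatiGain (ψ : SwitchingSequence J) (ε : ℝ) (r : ℕ) (i : Fin N) (k : ℕ) :
    Matrix (Fin m) (Fin n) ℝ :=
  (opW G i (riccatiAverage G Pi ψ ε r i k))⁻¹ * opR G i (riccatiAverage G Pi ψ ε r i k)

variable {G Pi} {ψ : SwitchingSequence J} {ε ρ κ : ℝ} {r : ℕ}

namespace RiccatiBound

theorem average_isSymm (h : RiccatiBound G Pi ψ ε ρ κ r) (i : Fin N) (k : ℕ) :
    (riccatiAverage G Pi ψ ε r i k).IsSymm :=
  modeAverage_isSymm (fun j => h.symm j (k + 1)) i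

theorem quad_opW (h : RiccatiBound G Pi ψ ε ρ κ r) (i : Fin N) (k : ℕ) (v : Fin m → ℝ) :
    κ * (v ⬝ᵥ v) ≤ quad (opW G i (riccatiAverage G Pi ψ ε r i k)) v := by
  have := h.stage i k 0 v
  rw [stageCost_zero_left G i (h.average_isSymm i k)] at this
  simp only [dotProduct_zero, mul_zero] at this
  linarith

theorem isUnit_opW (h : RiccatiBound G Pi ψ ε ρ κ r) (hκ : 0 < κ) (i : Fin N) (k : ℕ) :
    IsUnit (opW G i (riccatiAverage G Pi ψ ε r i k)) :=
  (posDef_of_quad (opW_isSymm G i (h.average_isSymm i k)) hκ (h.quad_opW i k)).isUnit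

theorem stageCost_gain (h : RiccatiBound G Pi ψ ε ρ κ r) (hκ : 0 < κ) (i : Fin N) (k : ℕ)
    (x : Fin n → ℝ) :
    stageCost G i (riccatiAverage G Pi ψ ε r i k) x (riccatiGain G Pi ψ ε r i k *ᵥ x)
      + ε * (x ⬝ᵥ x) = quad (riccatiSteps G Pi ψ ε (r + 1) i k) x := by
  rw [riccatiSteps_succ, quad_add, quad_smul, quad_one, riccatiGain,
    SwitchedMJLS.stageCost_gain G i (h.average_isSymm i k) (h.isUnit_opW hκ i k)]

theorem stageCost_le (h : RiccatiBound G Pi ψ ε ρ κ r) (hκ : 0 < κ) (i : Fin N) (k : ℕ)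
    (x : Fin n → ℝ) (v : Fin m → ℝ) :
    stageCost G i (riccatiAverage G Pi ψ ε r i k) x v + ε * (x ⬝ᵥ x)
      ≤ quad (riccatiSteps G Pi ψ ε (r + 1) i k) x := by
  rw [riccatiSteps_succ, quad_add, quad_smul, quad_one]
  have := stageCost_le_opS G i (h.average_isSymm i k) (h.isUnit_opW hκ i k)
    (fun v => (mul_nonneg hκ.le (dotProduct_self_nonneg' v)).trans (h.quad_opW i k v)) x v
  linarith

theorem le_succ (h : RiccatiBound G Pi ψ ε ρ κ r) (hPi : ∀ s, Pi s ∈ rowStochastic ℝ (Fin N))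
    (hκ : 0 < κ) (i : Fin N) (k : ℕ) (x : Fin n → ℝ) :
    ε * (x ⬝ᵥ x) ≤ quad (riccatiSteps G Pi ψ ε (r + 1) i k) x := by
  have h1 := h.stageCost_le hκ i k x 0
  have h2 := stageCost_zero_right_nonneg G i
    (fun y => quad_modeAverage_nonneg (hPi (ψ k.succPNat)) (fun j => h.nonneg j (k + 1) y) i) x
  rw [riccatiAverage] at h1
  linarith

/-- The worst-case gain attains the Riccati value, so the stage bound at that disturbance bounds the
value itself. -/
theorem succ_le (h : RiccatiBound G Pi ψ ε ρ κ r) (hκ : 0 < κ) (i : Fin N) (k : ℕ)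
    (x : Fin n → ℝ) : quad (riccatiSteps G Pi ψ ε (r + 1) i k) x ≤ ρ * (x ⬝ᵥ x) := by
  have h1 := h.stage i k x (riccatiGain G Pi ψ ε r i k *ᵥ x)
  rw [h.stageCost_gain hκ] at h1
  have := mul_nonneg hκ.le (dotProduct_self_nonneg' (riccatiGain G Pi ψ ε r i k *ᵥ x))
  linarith

theorem symm_succ (h : RiccatiBound G Pi ψ ε ρ κ r) (i : Fin N) (k : ℕ) :
    (riccatiSteps G Pi ψ ε (r + 1) i k).IsSymm := by
  rw [riccatiSteps_succ]
  exact (opS_isSymm G i (h.average_isSymm i k)).add (isSymm_one.smul ε)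

end RiccatiBound

variable {Ω : Type*} [MeasurableSpace Ω] {P : Measure Ω} [IsProbabilityMeasure P]

/-- Strong induction: the bound with `r` steps to go uses the gains with fewer steps to go, which
exist by the earlier bounds. The same `ρ` and `κ` serve at every stage. -/
theorem exists_riccatiBound (hPi : ∀ s, Pi s ∈ rowStochastic ℝ (Fin N))
    {Ψ : Set (SwitchingSequence J)} {p₀ : Fin N → ℝ}
    {θ : SwitchingSequence J → ℕ → Ω → Fin N}
    (hθ : ∀ ψ ∈ Ψ, IsMarkovChain P (θ ψ) p₀ (fun k => Pi (ψ k)))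
    (hpos : ∀ ψ ∈ Ψ, ∀ (i : Fin N) (k : ℕ), 0 < P.real {ω | θ ψ k ω = i})
    (hstab : UniformlyExpMeanSquareStable G P Ψ θ)
    (hcontr : UniformlyMeanSquareStrictlyContractive G P Ψ θ) :
    ∃ η ρ κ : ℝ, 0 < η ∧ 0 < ρ ∧ 0 < κ ∧ ∀ ψ ∈ Ψ, ∀ ε, 0 ≤ ε → ε ≤ η → ∀ r,
      RiccatiBound G Pi ψ ε ρ κ r := by
  obtain ⟨η, ρ, κ, hη, hρ, hκ, hb⟩ := exists_stageCost_bound hPi hθ hpos hstab hcontr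
  refine ⟨η, ρ, κ, hη, hρ, hκ, fun ψ hψ ε hε0 hε r => ?_⟩
  induction r using Nat.strong_induction_on with
  | _ r ih =>
    refine ⟨fun i k => ?_, fun i k x => ?_, fun i k x v => ?_⟩
    · cases r with
      | zero => exact isSymm_zero
      | succ r => exact (ih r (by omega)).symm_succ i k
    · cases r with
      | zero => simp [riccatiSteps]
      | succ r =>
        exact (mul_nonneg hε0 (dotProduct_self_nonneg' x)).trans
          ((ih r (by omega)).le_succ hPi hκ i k x)
    · have := hb ψ hψ ε hε0 hε k r i
        (fun s j => riccatiSteps G Pi ψ ε (r + 1 - s) j (k + s))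
        -- Past the horizon the truncated subtraction would keep the gain with `0` steps to go,
        -- which need not vanish, so the gain is cut off explicitly.
        (fun s j => if s ≤ r then riccatiGain G Pi ψ ε (r - s) j (k + s) else 0)
        (by funext j; simp [riccatiSteps])
        (fun s hs => by funext j; simp [show ¬ s ≤ r by omega])
        (fun s h1 h2 j x => ?_) x v
      · exact this
      · simp only [h2, if_true]
        rw [show r + 1 - s = r - s + 1 by omega, ← (ih (r - s) (by omega)).stageCost_gain hκ,
          show r + 1 - (s + 1) = r - s by omega]
        rfl

/-- The Riccati solution with `r` steps to go depends only on the next `r - 1` values of the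
switching sequence. -/
theorem riccatiSteps_congr {ψ φ : SwitchingSequence J} {M k t : ℕ}
    (h : window ψ M k = window φ M t) (i : Fin N) :
    riccatiSteps G Pi ψ ε (M + 1) i k = riccatiSteps G Pi φ ε (M + 1) i t := by
  induction M generalizing i k t with
  -- The step from the zero final condition averages zeros and sees no switching value; hence `M +
  -- 1` steps for a window of length `M`.
  | zero => simp [riccatiSteps]
  | succ M ih =>
    have h0 : ψ k.succPNat = φ t.succPNat := by simpa [window] using congrFun h 0
    have h1 : window ψ M (k + 1) = window φ M (t + 1) := by
      funext l
      have := congrFun h l.succ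
      simp only [window, Fin.val_succ] at this ⊢
      rwa [show k + 1 + (l : ℕ) = k + (l + 1) by omega, show t + 1 + (l : ℕ) = t + (l + 1) by omega]
    rw [riccatiSteps_succ, riccatiSteps_succ, riccatiAverage, riccatiAverage, h0]
    simp only [ih h1]

/-! ### Geometric convergence in the horizon and the storage function -/

/-- The difference of two Riccati solutions for different perturbations is a Lyapunov function
of the closed loop with the worst-case feedback. -/
theorem riccati_lyapunov {ε' : ℝ} (h : RiccatiBound G Pi ψ ε ρ κ r)
    (h' : RiccatiBound G Pi ψ ε' ρ κ r) (hκ : 0 < κ) (i : Fin N) (k : ℕ) (x : Fin n → ℝ) :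
    quad (riccatiAverage G Pi ψ ε' r i k - riccatiAverage G Pi ψ ε r i k)
        (G.A i *ᵥ x + G.B i *ᵥ (riccatiGain G Pi ψ ε r i k *ᵥ x)) + (ε' - ε) * (x ⬝ᵥ x)
      ≤ quad (riccatiSteps G Pi ψ ε' (r + 1) i k - riccatiSteps G Pi ψ ε (r + 1) i k) x := by
  rw [quad_sub (riccatiSteps _ _ _ _ _ _ _), ← h.stageCost_gain hκ, ← stageCost_sub]
  have := h'.stageCost_le hκ i k x (riccatiGain G Pi ψ ε r i k *ᵥ x)
  linarith

/-- The increment is at most its own average at the successor state under the worst-case gain. The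
Lyapunov function contracts along that loop by the factor `1 - (ε' - ε) / ρ`, so the comparison
propagates by induction. -/
theorem riccati_increment_le (hPi : ∀ s, Pi s ∈ rowStochastic ℝ (Fin N)) {ε' : ℝ}
    (hε : ε < ε') (hρ : 0 < ρ) (hκ : 0 < κ) (ha : ε' - ε ≤ ρ)
    (h : ∀ r, RiccatiBound G Pi ψ ε ρ κ r) (h' : ∀ r, RiccatiBound G Pi ψ ε' ρ κ r)
    (r : ℕ) (i : Fin N) (k : ℕ) (x : Fin n → ℝ) :
    quad (riccatiSteps G Pi ψ ε (r + 1) i k) x - quad (riccatiSteps G Pi ψ ε r i k) x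
      ≤ ρ / (ε' - ε) * (1 - (ε' - ε) / ρ) ^ r
        * (quad (riccatiSteps G Pi ψ ε' (r + 1) i k) x
          - quad (riccatiSteps G Pi ψ ε (r + 1) i k) x) := by
  have hd : 0 < ε' - ε := by linarith
  have ha1 : 0 ≤ 1 - (ε' - ε) / ρ := by
    rw [sub_nonneg, div_le_one hρ]; exact ha
  induction r generalizing i k x with
  | zero =>
    have h1 := riccati_lyapunov (h 0) (h' 0) hκ i k x
    -- With no steps to go the two averages coincide, so the Lyapunov function is at least `(ε' - ε)
    -- * (x ⬝ᵥ x)`, while the first increment is at most `ρ * (x ⬝ᵥ x)`.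
    have h2 := (h 0).succ_le hκ i k x
    have h3 : riccatiAverage G Pi ψ ε' 0 i k = riccatiAverage G Pi ψ ε 0 i k := rfl
    have h4 : quad (riccatiSteps G Pi ψ ε 0 i k) x = 0 := quad_zero x
    rw [h3, sub_self, quad_zero, zero_add, quad_sub] at h1
    rw [h4, sub_zero, pow_zero, mul_one]
    refine h2.trans ?_
    calc ρ * (x ⬝ᵥ x) = ρ / (ε' - ε) * ((ε' - ε) * (x ⬝ᵥ x)) := by field_simp
      _ ≤ _ := mul_le_mul_of_nonneg_left h1 (by positivity)
  | succ r ih =>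
    set c := ρ / (ε' - ε) * (1 - (ε' - ε) / ρ) ^ r with hc
    have hc0 : 0 ≤ c := by positivity
    set y := G.A i *ᵥ x + G.B i *ᵥ (riccatiGain G Pi ψ ε (r + 1) i k *ᵥ x) with hy
    have h1 := riccati_lyapunov (h (r + 1)) (h' (r + 1)) hκ i k x
    rw [quad_sub, quad_sub, ← hy] at h1
    have h2 : quad (riccatiAverage G Pi ψ ε (r + 1) i k) y
        - quad (riccatiAverage G Pi ψ ε r i k) y
        ≤ c * (quad (riccatiAverage G Pi ψ ε' (r + 1) i k) y
          - quad (riccatiAverage G Pi ψ ε (r + 1) i k) y) := by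
      simp only [riccatiAverage, quad_modeAverage, ← Finset.sum_sub_distrib, Finset.mul_sum]
      refine Finset.sum_le_sum fun j _ => ?_
      have := mul_le_mul_of_nonneg_left (ih j (k + 1) y) ((hPi (ψ k.succPNat)).1 i j)
      linarith
    -- The gain that is optimal with `r + 1` steps to go is merely admissible with `r`, so the
    -- comparison bounds the increment from above, which is all that is needed.
    have h3 := (h r).stageCost_le hκ i k x (riccatiGain G Pi ψ ε (r + 1) i k *ᵥ x)
    have h4 := (h (r + 1)).stageCost_gain hκ i k x
    have h5 := stageCost_sub G i (riccatiAverage G Pi ψ ε (r + 1) i k)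
      (riccatiAverage G Pi ψ ε r i k) x (riccatiGain G Pi ψ ε (r + 1) i k *ᵥ x)
    rw [quad_sub, ← hy] at h5
    have h6 : quad (riccatiSteps G Pi ψ ε' (r + 1 + 1) i k) x
        - quad (riccatiSteps G Pi ψ ε (r + 1 + 1) i k) x ≤ ρ * (x ⬝ᵥ x) := by
      have := (h (r + 2)).nonneg i k x
      have := (h' (r + 1)).succ_le hκ i k x
      linarith
    set V := quad (riccatiSteps G Pi ψ ε' (r + 1 + 1) i k) x
        - quad (riccatiSteps G Pi ψ ε (r + 1 + 1) i k) x with hV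
    -- The loss per step is a fixed fraction of the Lyapunov function, since the latter is at most
    -- `ρ * (x ⬝ᵥ x)`.
    have h7 : (ε' - ε) / ρ * V ≤ (ε' - ε) * (x ⬝ᵥ x) := by
      calc _ ≤ (ε' - ε) / ρ * (ρ * (x ⬝ᵥ x)) := mul_le_mul_of_nonneg_left h6 (by positivity)
        _ = _ := by field_simp
    calc _ ≤ c * (quad (riccatiAverage G Pi ψ ε' (r + 1) i k) y
          - quad (riccatiAverage G Pi ψ ε (r + 1) i k) y) := by linarith
      _ ≤ c * (V - (ε' - ε) / ρ * V) := mul_le_mul_of_nonneg_left (by linarith) hc0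
      _ = _ := by rw [hc, pow_succ]; ring

/-- Uniform smallness of the increments of the Riccati solution in the horizon. -/
theorem exists_riccati_increment_le (hPi : ∀ s, Pi s ∈ rowStochastic ℝ (Fin N)) {ε' : ℝ}
    (hε0 : 0 < ε) (hε : ε < ε') (hρ : 0 < ρ) (hκ : 0 < κ) {Ψ : Set (SwitchingSequence J)}
    (h : ∀ ψ ∈ Ψ, ∀ r, RiccatiBound G Pi ψ ε ρ κ r)
    (h' : ∀ ψ ∈ Ψ, ∀ r, RiccatiBound G Pi ψ ε' ρ κ r) (ha : ε' - ε ≤ ρ) :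
    ∃ M : ℕ, ∀ ψ ∈ Ψ, ∀ i k x, quad (riccatiSteps G Pi ψ ε (M + 2) i k) x
      - quad (riccatiSteps G Pi ψ ε (M + 1) i k) x ≤ ε / 2 * (x ⬝ᵥ x) := by
  have hd : 0 < ε' - ε := by linarith
  have ha0 : 0 ≤ 1 - (ε' - ε) / ρ := by
    rw [sub_nonneg, div_le_one hρ]; exact ha
  have ha1 : 1 - (ε' - ε) / ρ < 1 := by
    have : 0 < (ε' - ε) / ρ := div_pos hd hρ
    linarith
  have hC : 0 < ρ / (ε' - ε) * ρ := by positivity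
  obtain ⟨M, hM⟩ := exists_pow_lt_of_lt_one (show 0 < ε / 2 / (ρ / (ε' - ε) * ρ) by positivity) ha1
  refine ⟨M, fun ψ hψ i k x => ?_⟩
  refine (riccati_increment_le hPi hε hρ hκ ha (h ψ hψ) (h' ψ hψ) (M + 1) i k x).trans ?_
  have h6 : quad (riccatiSteps G Pi ψ ε' (M + 1 + 1) i k) x
      - quad (riccatiSteps G Pi ψ ε (M + 1 + 1) i k) x ≤ ρ * (x ⬝ᵥ x) := by
    have := (h ψ hψ (M + 2)).nonneg i k x
    have := (h' ψ hψ (M + 1)).succ_le hκ i k x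
    linarith
  have h7 : (1 - (ε' - ε) / ρ) ^ (M + 1) ≤ ε / 2 / (ρ / (ε' - ε) * ρ) :=
    (pow_le_pow_of_le_one ha0 ha1.le (Nat.le_succ M)).trans hM.le
  have hx := dotProduct_self_nonneg' x
  calc _ ≤ ρ / (ε' - ε) * (1 - (ε' - ε) / ρ) ^ (M + 1) * (ρ * (x ⬝ᵥ x)) :=
        mul_le_mul_of_nonneg_left h6 (by positivity)
    _ = ρ / (ε' - ε) * ρ * (1 - (ε' - ε) / ρ) ^ (M + 1) * (x ⬝ᵥ x) := by ring
    _ ≤ ρ / (ε' - ε) * ρ * (ε / 2 / (ρ / (ε' - ε) * ρ)) * (x ⬝ᵥ x) := by gcongr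
    _ = _ := by rw [mul_div_cancel₀ _ hC.ne']

/-- One more backward step gains `ε * (x ⬝ᵥ x)`, and replacing its value by the truncated one loses
at most half of that. This is strict in `x` only; strictness in `v` comes from mixing in the stage
bound. -/
theorem isFiniteDependenceStorage_riccati (hPi : ∀ s, Pi s ∈ rowStochastic ℝ (Fin N)) {M : ℕ}
    (hε : 0 < ε) (hρ : 0 < ρ) (hκ : 0 < κ) {Ψ : Set (SwitchingSequence J)}
    (h : ∀ ψ ∈ Ψ, ∀ r, RiccatiBound G Pi ψ ε ρ κ r)
    (hM : ∀ ψ ∈ Ψ, ∀ i k x, quad (riccatiSteps G Pi ψ ε (M + 2) i k) x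
      - quad (riccatiSteps G Pi ψ ε (M + 1) i k) x ≤ ε / 2 * (x ⬝ᵥ x)) :
    ∃ ν : ℝ, 0 < ν ∧ IsFiniteDependenceStorage G Pi Ψ ε ρ ν M
      (fun ψ i k => riccati G Pi ψ (k + M) ε i k) := by
  have hY : ∀ ψ i k, riccati G Pi ψ (k + M) ε i k = riccatiSteps G Pi ψ ε (M + 1) i k :=
    fun ψ i k => by rw [riccati, show k + M + 1 - k = M + 1 by omega]
  -- Weight of the stage bound in the convex combination: its `ρ`-term costs at most `ε / 8`, while
  -- the other part keeps at least `ε / 4`.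
  set τ : ℝ := min (1 / 2) (ε / (8 * ρ)) with hτ
  have hτ0 : 0 < τ := lt_min (by norm_num) (by positivity)
  have hτ1 : τ ≤ 1 / 2 := min_le_left _ _
  have hτ2 : τ * ρ ≤ ε / 8 := by
    calc τ * ρ ≤ ε / (8 * ρ) * ρ := mul_le_mul_of_nonneg_right (min_le_right _ _) hρ.le
      _ = ε / 8 := by field_simp
  refine ⟨min (ε / 8) (τ * κ), lt_min (by positivity) (by positivity), ?_⟩
  simp only [hY]
  refine ⟨fun ψ hψ i k => posDef_of_quad ((h ψ hψ M).symm_succ i k) hε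
    ((h ψ hψ M).le_succ hPi hκ i k), fun ψ _ φ _ i k t hw => ?_, fun ψ hψ i k => ⟨?_, ?_, ?_⟩⟩
  · exact riccatiSteps_congr hw i
  · refine le_of_quad_le (isSymm_one.smul ε) ((h ψ hψ M).symm_succ i k) fun x => ?_
    rw [quad_smul, quad_one]
    exact (h ψ hψ M).le_succ hPi hκ i k x
  · refine le_of_quad_le ((h ψ hψ M).symm_succ i k) (isSymm_one.smul ρ) fun x => ?_
    rw [quad_smul, quad_one]
    exact (h ψ hψ M).succ_le hκ i k x
  · have hav : tildeNext Pi ψ (fun i k => riccati G Pi ψ (k + M) ε i k) i k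
        = riccatiAverage G Pi ψ ε (M + 1) i k := by
      simp only [hY]; rfl
    simp only [hY] at hav
    rw [hav]
    refine le_of_quad_le (kyp_isSymm G i ((h ψ hψ (M + 1)).average_isSymm i k)
      ((h ψ hψ M).symm_succ i k)) (isSymm_one.smul _).neg fun u => ?_
    rw [quad_kyp, quad_neg, quad_smul, quad_one]
    set x := u ∘ Sum.inl with hx
    set v := u ∘ Sum.inr with hv
    have hu : u ⬝ᵥ u = x ⬝ᵥ x + v ⬝ᵥ v := by
      rw [← sumElim_dotProduct_sumElim, hx, hv, Sum.elim_comp_inl_inr]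
    have h1 := (h ψ hψ (M + 1)).stage i k x v
    have h2 := (h ψ hψ (M + 1)).stageCost_le hκ i k x v
    have h3 := hM ψ hψ i k x
    have h4 := (h ψ hψ (M + 1)).nonneg i k x
    have hxx := dotProduct_self_nonneg' x
    have hvv := dotProduct_self_nonneg' v
    rw [show M + 1 + 1 = M + 2 by omega] at h2
    set S := stageCost G i (riccatiAverage G Pi ψ ε (M + 1) i k) x v
    set Yx := quad (riccatiSteps G Pi ψ ε (M + 1) i k) x
    have h5 : τ * (S - Yx) ≤ τ * (ρ * (x ⬝ᵥ x) - κ * (v ⬝ᵥ v)) := by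
      refine mul_le_mul_of_nonneg_left ?_ hτ0.le
      have := mul_nonneg hε.le hxx
      linarith
    have h6 : (1 - τ) * (S - Yx) ≤ (1 - τ) * (-(ε / 2) * (x ⬝ᵥ x)) :=
      mul_le_mul_of_nonneg_left (by linarith) (by linarith)
    have h7 : τ * ρ * (x ⬝ᵥ x) ≤ ε / 8 * (x ⬝ᵥ x) := mul_le_mul_of_nonneg_right hτ2 hxx
    have h8 : τ * (ε / 2 * (x ⬝ᵥ x)) ≤ 1 / 2 * (ε / 2 * (x ⬝ᵥ x)) :=
      mul_le_mul_of_nonneg_right hτ1 (by positivity)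
    have h9 : min (ε / 8) (τ * κ) * (x ⬝ᵥ x) ≤ ε / 8 * (x ⬝ᵥ x) :=
      mul_le_mul_of_nonneg_right (min_le_left _ _) hxx
    have h10 : min (ε / 8) (τ * κ) * (v ⬝ᵥ v) ≤ τ * κ * (v ⬝ᵥ v) :=
      mul_le_mul_of_nonneg_right (min_le_right _ _) hvv
    rw [hu]
    linarith

end Riccati

end SwitchedMJLS

end

/-! ### Conclusion -/

theorem mainTheorem3 {Ω : Type*} [MeasurableSpace Ω] (P : Measure Ω) [IsProbabilityMeasure P]
    {N n m q J : ℕ} (G : SwitchedMJLS.SystemMatrices N n m q)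
    (Pi : Fin J → Matrix (Fin N) (Fin N) ℝ) (hPi : ∀ s, Pi s ∈ Matrix.rowStochastic ℝ (Fin N))
    (Ψ : Set (SwitchedMJLS.SwitchingSequence J)) (p₀ : Fin N → ℝ)
    (θ : SwitchedMJLS.SwitchingSequence J → ℕ → Ω → Fin N)
    (hθ : ∀ ψ ∈ Ψ, SwitchedMJLS.IsMarkovChain P (θ ψ) p₀ (fun k => Pi (ψ k)))
    (hpos : ∀ ψ ∈ Ψ, ∀ (i : Fin N) (k : ℕ), 0 < P.real {ω | θ ψ k ω = i})
    (hstab : SwitchedMJLS.UniformlyExpMeanSquareStable G P Ψ θ)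
    (hcontr : SwitchedMJLS.UniformlyMeanSquareStrictlyContractive G P Ψ θ) :
    -- existence of storage matrix functions with finite dependence on the future
    (∃ (η ρ ν : ℝ) (M : ℕ), 0 < η ∧ 0 < ρ ∧ 0 < ν ∧
      ∃ Y : SwitchedMJLS.SwitchingSequence J → Fin N → ℕ → Matrix (Fin n) (Fin n) ℝ,
        SwitchedMJLS.IsFiniteDependenceStorage G Pi Ψ η ρ ν M Y) ∧
    -- the explicit construction by truncated perturbed Riccati solutions
    ∃ η ρ : ℝ, 0 < η ∧ 0 < ρ ∧ ∀ ε : ℝ, 0 < ε → ε < η →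
      (∀ ψ ∈ Ψ, ∀ (i : Fin N) (T k : ℕ), k ≤ T →
        SwitchedMJLS.tildeNext Pi ψ (SwitchedMJLS.riccati G Pi ψ T ε) i k
          ∈ SwitchedMJLS.domainS G i) ∧
      ∃ (M : ℕ) (ν : ℝ), 0 < ν ∧
        SwitchedMJLS.IsFiniteDependenceStorage G Pi Ψ ε ρ ν M
          (fun ψ i k => SwitchedMJLS.riccati G Pi ψ (k + M) ε i k) := by
  obtain ⟨η, ρ, κ, hη, hρ, hκ, hb⟩ :=
    SwitchedMJLS.exists_riccatiBound hPi hθ hpos hstab hcontr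
  -- This minimum also serves as the larger perturbation `ε'`; being at most `ρ`, it keeps the
  -- contraction factor nonnegative.
  have hη' : 0 < min η ρ := lt_min hη hρ
  have key : ∀ ε : ℝ, 0 < ε → ε < min η ρ → ∃ (M : ℕ) (ν : ℝ), 0 < ν ∧
      SwitchedMJLS.IsFiniteDependenceStorage G Pi Ψ ε ρ ν M
        (fun ψ i k => SwitchedMJLS.riccati G Pi ψ (k + M) ε i k) := by
    intro ε h0 h1
    have h2 : min η ρ ≤ η := min_le_left _ _
    have h3 : min η ρ ≤ ρ := min_le_right _ _
    have h := fun ψ hψ => hb ψ hψ ε h0.le (h1.le.trans h2)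
    have h' := fun ψ hψ => hb ψ hψ (min η ρ) hη'.le h2
    obtain ⟨M, hM⟩ :=
      SwitchedMJLS.exists_riccati_increment_le hPi h0 h1 hρ hκ h h' (by linarith)
    exact ⟨M, SwitchedMJLS.isFiniteDependenceStorage_riccati hPi h0 hρ hκ h hM⟩
  refine ⟨?_, min η ρ, ρ, hη', hρ, fun ε h0 h1 => ⟨fun ψ hψ i T k hk => ?_, key ε h0 h1⟩⟩
  · obtain ⟨M, ν, hν, hY⟩ := key (min η ρ / 2) (half_pos hη') (half_lt_self hη')
    exact ⟨min η ρ / 2, ρ, ν, M, half_pos hη', hρ, hν, _, hY⟩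
  · have h := hb ψ hψ ε h0.le (h1.le.trans (min_le_left _ _)) (T + 1 - (k + 1))
    exact ⟨h.average_isSymm i k, h.isUnit_opW hκ i k⟩
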